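/- **Setting.** Let $E$ be a CW complex with sets of cells $\mathcal{E}_i$ and integer incidence numbers $d_{\alpha\beta}$ for $(\alpha,\beta)\in\mathcal{E}_{i}\times\mathcal{E}_{i-1}$: $d_{\alpha\beta}$ is the degree of the map $S^{i-1}\to E^{i-1}\to S^{i-1}$ composed of the attaching map of $\alpha$ and the collapse of the complement of the cell $\beta$ in the skeleton $E^{i-1}$. Assume that for each cell $\beta$ only finitely many $d_{\alpha\beta}$ are non-zero. Let $n\in\mathbb{N}$ (with $\mathcal{E}_{-1}=\emptyset$), let $G$ be a finite abelian group and $\hat G=\mathrm{Hom}(G,\mathbb{Q}/\mathbb{Z})$. Write $C^{\mathrm{lf}}_i=\prod_{\mathcal{E}_i}\hat G\supseteq C_i=\bigoplus_{\mathcal{E}_i}\hat G$ and $C^i=\prod_{\mathcal{E}_i}G\supseteq C^i_{\mathrm{lf}}=\bigoplus_{\mathcal{E}_i}G$, with boundary map $\partial$ given by $(\partial c)_\beta=\sum_\alpha d_{\alpha\beta}c_\alpha$ and coboundary map $\partial^T$ given by $(\partial^Tc)_\alpha=\sum_\beta d_{\alpha\beta}c_\beta$. Let $\langle\sum\chi_\alpha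 e_\alpha,\sum g_\alpha e_\alpha\rangle=\sum_\alpha\chi_\alpha(g_\alpha)\in\mathbb{Q}/\mathbb{Z}$ whenever one of the supports is finite, and let $c_K$ denote the restriction of $c$ to a finite set $K$ of cells. Let $\mathfrak{A}$ be the quasi-local C*-algebra with one site, with Hilbert space $\ell^2(G)$, for each $n$-cell (the C*-inductive limit of the algebras $B(\bigotimes_{\Lambda}\ell^2(G))$ over finite $\Lambda\subseteq\mathcal{E}_n$). For $a\in C^n_{\mathrm{lf}}$ and $b\in C_n$ let $X^a=\prod_\alpha (X^{a_\alpha})_\alpha$ and $Z^b=\prod_\alpha(Z^{b_\alpha})_\alpha$, where $X^g|h\rangle=|g+h\rangle$ and $Z^\chi|h\rangle=e^{2\pi i\chi(h)}|h\rangle$. Let $\omega_0$ be a pure frustration free ground state, i.e. a pure state of $\mathfrak{A}$ that takes the value $1$ on all the projections $A_\alpha=\frac{1}{|G|}\sum_{g\in G}X^{\partial^T(ge_\alpha)}$ ($\alpha\in\mathcal{E}_{n-1}$) and $B_\beta=\frac{1}{|G|}\sum_{\chi\in\hat G}Z^{\partial(\chi e_\beta)}$ ($\beta\in\mathcal{E}_{n+1}$),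 and let $\pi_0$ be its GNS representation. For $\gamma\in C_n^{\mathrm{lf}}$ and $\delta\in C^n$ let $\rho_{(\gamma,\delta)}=\rho_\gamma\circ\rho_\delta$, where $\rho_\gamma(A)=\lim_{K\to\mathcal{E}_n}Z^{\gamma_K}AZ^{-\gamma_K}$ and $\rho_\delta(A)=\lim_{K\to\mathcal{E}_n}X^{\delta_K}AX^{-\delta_K}$ in norm. **Proposition.** For $i=1,2$ let $\gamma_i\in C^{\mathrm{lf}}_n$ and $\delta_i\in C^n$ be such that $\partial\gamma_i$ and $\partial^T\delta_i$ have finite support. Let $\hat\gamma_i\in C_n$, $\hat\delta_i\in C^n_{\mathrm{lf}}$, $p_i\in C^{\mathrm{lf}}_{n+1}$ and $q_i\in C^{n-1}$ be arbitrary, and for finite $K_\pm\subseteq\mathcal{E}_{n\pm1}$ let $$U_{i,K_+,K_-}=Z^{-\hat\gamma_i}X^{-\hat\delta_i}X^{\partial^T(q_{i,K_-})}Z^{\partial(p_{i,K_+})}.$$ Then, in the strong operator topology, the limits $U_i=\lim_{K_\pm\to\mathcal{E}_{n\pm1}}\pi_0(U_{i,K_+,K_-})$ exist, and so does the limit $$\lim_{K_\pm\to\mathcal{E}_{n\pm1}}\pi_0\big(\rho_{(\gamma_2,\delta_2)}(U_{1,K_+,K_-}^*)\big)\,U_2^*U_1\,\pi_0\big(\rho_{(\gamma_1,\delta_1)}(U_{2,K_+,K_-})\big),$$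 which is equal to $e^{2\pi i(\theta_{12}-\theta_{21})}\,\pi_0(I)$ with $$\theta_{12}=\langle\gamma_2,\hat\delta_1\rangle+\langle\hat\gamma_2,\delta_1\rangle-\langle\hat\gamma_2,\hat\delta_1\rangle+\langle\partial\hat\gamma_2,q_1\rangle-\langle\partial\gamma_2,q_1\rangle+\langle p_2,\partial^T\hat\delta_1\rangle-\langle p_2,\partial^T\delta_1\rangle$$ and $\theta_{21}$ obtained from $\theta_{12}$ by interchanging $1$ and $2$. -/

import Mathlib

noncomputable section

namespace CellModel

open Topology Metric CategoryTheory

/-- The `k`-sphere, as the boundary of the cube `[-1,1]^(k+1)`. -/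
abbrev Sph (k : ℕ) : Type := sphere (0 : Fin (k + 1) → ℝ) 1

/-- Singular homology with integer coefficients. -/
abbrev singularH (k : ℕ) : TopCat.{0} ⥤ ModuleCat.{0} ℤ :=
  (AlgebraicTopology.singularHomologyFunctor (ModuleCat.{0} ℤ) k).obj (ModuleCat.of ℤ ℤ)

/-- The linear map induced by a continuous map on the `k`-th singular homology. -/
def homologyMap (k : ℕ) {S T : Type} [TopologicalSpace S] [TopologicalSpace T] (f : C(S, T)) :
    (singularH k).obj (TopCat.of S) →ₗ[ℤ] (singularH k).obj (TopCat.of T) :=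
  ((singularH k).map (TopCat.ofHom f)).hom

/-- Reduced homology, as the kernel of the map induced by the projection to a point. -/
def reducedH (k : ℕ) (S : Type) [TopologicalSpace S] :
    Submodule ℤ ((singularH k).obj (TopCat.of S)) :=
  LinearMap.ker (homologyMap k (ContinuousMap.const S PUnit.unit))

/-- `f : S^k → S^k` induces multiplication by `d` on the `k`-th reduced homology (`≅ ℤ`). -/
def HasDegree {k : ℕ} (f : C(Sph k, Sph k)) (d : ℤ) : Prop :=
  ∀ x ∈ reducedH k (Sph k), homologyMap k f x = d • x

open Classical in
/-- The degree of a map `S^k → S^k`: the integer by which it acts on reduced homology. Since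
`H̃_k(S^k) ≅ ℤ`, there is exactly one such integer. -/
def degree {k : ℕ} (f : C(Sph k, Sph k)) : ℤ :=
  if HasDegree f 0 then 0 else Classical.epsilon (HasDegree f)

theorem degree_const {k : ℕ} (y : Sph k) : degree (ContinuousMap.const (Sph k) y) = 0 := by
  have h : HasDegree (ContinuousMap.const (Sph k) y) 0 := by
    intro x hx
    have hc : TopCat.ofHom (ContinuousMap.const (Sph k) y) =
        TopCat.ofHom (ContinuousMap.const (Sph k) PUnit.unit) ≫
          TopCat.ofHom (ContinuousMap.const PUnit.{1} y) := rfl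
    have h0 : homologyMap k (ContinuousMap.const (Sph k) PUnit.unit) x = 0 := hx
    unfold homologyMap at h0 ⊢
    rw [hc, Functor.map_comp, ModuleCat.hom_comp, LinearMap.comp_apply, h0, map_zero, zero_smul]
  simp [degree, h]

/-- The vector `(1 - 2‖x‖, (1 - ‖x‖) x)`, which does not vanish and, on the boundary of the ball,
equals `(-1, 0)`. -/
def collapseVec {k : ℕ} (x : Fin k → ℝ) : Fin (k + 1) → ℝ :=
  Fin.cons (1 - 2 * ‖x‖) ((1 - ‖x‖) • x)

theorem collapseVec_ne_zero {k : ℕ} (x : Fin k → ℝ) : collapseVec x ≠ 0 := by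
  intro h
  have h0 : 1 - 2 * ‖x‖ = 0 := by simpa [collapseVec] using congrFun h 0
  have h1 : (1 - ‖x‖) • x = 0 := by
    ext i
    simpa [collapseVec] using congrFun h i.succ
  have hx : ‖x‖ = 1 / 2 := by linarith
  rcases smul_eq_zero.1 h1 with h2 | h2
  · linarith
  · rw [h2, norm_zero] at hx
    norm_num at hx

/-- The standard identification of `D^k / ∂D^k` with `S^k`, as a map `D^k → S^k`: the centre goes to
`(1, 0)`, the boundary goes to the base point `(-1, 0)`, and near the centre the last `k`
coordinates are those of `D^k`. -/
def collapse {k : ℕ} (x : Fin k → ℝ) : Sph k :=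
  ⟨‖collapseVec x‖⁻¹ • collapseVec x, by
    have := norm_ne_zero_iff.2 (collapseVec_ne_zero x)
    simp [norm_smul, this]⟩

/-- The base point of `S^k`. -/
def basePt (k : ℕ) : Sph k :=
  ⟨Fin.cons (-1) 0, by
    rw [mem_sphere_zero_iff_norm]
    refine le_antisymm ((pi_norm_le_iff_of_nonneg zero_le_one).2 ?_) ?_
    · intro i
      refine Fin.cases ?_ (fun j => ?_) i <;> simp
    · simpa using norm_le_pi_norm (Fin.cons (-1 : ℝ) (0 : Fin k → ℝ) : Fin (k + 1) → ℝ) 0⟩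

theorem continuous_collapse {k : ℕ} : Continuous (collapse : (Fin k → ℝ) → Sph k) := by
  have h : Continuous (collapseVec : (Fin k → ℝ) → _) := by
    refine continuous_pi fun i => ?_
    refine Fin.cases ?_ (fun j => ?_) i
    · simp only [collapseVec, Fin.cons_zero]
      fun_prop
    · simp only [collapseVec, Fin.cons_succ, Pi.smul_apply, smul_eq_mul]
      fun_prop
  refine Continuous.subtype_mk ?_ _
  exact (h.norm.inv₀ fun x => norm_ne_zero_iff.2 (collapseVec_ne_zero x)).smul h

theorem collapse_of_norm_eq_one {k : ℕ} {x : Fin k → ℝ} (hx : ‖x‖ = 1) :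
    collapse x = basePt k := by
  have h : collapseVec x = (basePt k : Fin (k + 1) → ℝ) := by
    simp only [collapseVec, basePt, hx]
    norm_num
  have hb : ‖(basePt k : Fin (k + 1) → ℝ)‖ = 1 := mem_sphere_zero_iff_norm.1 (basePt k).2
  ext1
  simp only [collapse, h, hb, inv_one, one_smul]

section CW

variable {X : Type*} [TopologicalSpace X] {C : Set X} [CWComplex C]

open Classical in
/-- The map from the `k`-skeleton to `S^k` that collapses the complement of the open `k`-cell `β` to
the base point and is the inverse of the characteristic map, followed by `collapse`, on `β`. -/
def cellQuotient {k : ℕ} (β : RelCWComplex.cell C k) (y : X) : Sph k :=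
  if y ∈ RelCWComplex.openCell k β then collapse ((RelCWComplex.map k β).symm y) else basePt k

theorem disjoint_openCell [T2Space X] {k m : ℕ} {β : RelCWComplex.cell C k} {j : RelCWComplex.cell C m}
    (hm : m < k + 1) (hne : (⟨m, j⟩ : Σ n, RelCWComplex.cell C n) ≠ ⟨k, β⟩) :
    Disjoint (RelCWComplex.closedCell m j) (RelCWComplex.openCell k β) := by
  rw [← RelCWComplex.cellFrontier_union_openCell_eq_closedCell, Set.disjoint_union_left]
  refine ⟨?_, RelCWComplex.disjoint_openCell_of_ne hne⟩
  refine Disjoint.mono_left (RelCWComplex.cellFrontier_subset_skeletonLT m j) ?_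
  have hmk : (m : ℕ∞) ≤ (k : ℕ∞) := by exact_mod_cast Nat.lt_succ_iff.1 hm
  exact RelCWComplex.disjoint_skeletonLT_openCell hmk

theorem cellQuotient_map [T2Space X] {k : ℕ} (β : RelCWComplex.cell C k) {x : Fin k → ℝ}
    (hx : x ∈ closedBall (0 : Fin k → ℝ) 1) :
    cellQuotient β (RelCWComplex.map k β x) = collapse x := by
  rcases lt_or_eq_of_le (mem_closedBall_zero_iff.1 hx) with h | h
  · have hb : x ∈ ball (0 : Fin k → ℝ) 1 := mem_ball_zero_iff.2 h
    have ho : RelCWComplex.map k β x ∈ RelCWComplex.openCell k β := Set.mem_image_of_mem _ hb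
    rw [cellQuotient, if_pos ho, PartialEquiv.left_inv]
    rwa [RelCWComplex.source_eq]
  · rw [cellQuotient, if_neg, collapse_of_norm_eq_one h]
    intro hm
    have hf : RelCWComplex.map k β x ∈ RelCWComplex.cellFrontier k β :=
      Set.mem_image_of_mem _ (mem_sphere_zero_iff_norm.2 h)
    exact Set.disjoint_left.1 (RelCWComplex.disjoint_skeletonLT_openCell (le_refl _))
      (RelCWComplex.cellFrontier_subset_skeletonLT k β hf) hm

/-- The map `S^k → E^k → S^k` obtained from the attaching map of a `(k+1)`-cell `α` and the collapse
of the complement of a `k`-cell `β` is continuous. -/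
theorem continuous_attaching [T2Space X] {k : ℕ} (α : RelCWComplex.cell C (k + 1))
    (β : RelCWComplex.cell C k) :
    Continuous fun s : Sph k => cellQuotient β (RelCWComplex.map (k + 1) α s) := by
  classical
  obtain ⟨I, hI⟩ := CWComplex.cellFrontier_subset_finite_closedCell (k + 1) α
  have hφ : Continuous fun s : Sph k => RelCWComplex.map (k + 1) α s :=
    ((RelCWComplex.continuousOn (k + 1) α).mono sphere_subset_closedBall).domRestrict
  -- the part of the boundary that lies outside of the open cell `β`
  let R : Set X := RelCWComplex.cellFrontier k β ∪ ⋃ m ∈ Finset.range (k + 1), ⋃ j ∈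
    (I m).filter (fun j => (⟨m, j⟩ : Σ n, RelCWComplex.cell C n) ≠ ⟨k, β⟩),
      RelCWComplex.closedCell m j
  have hRc : IsClosed R :=
    RelCWComplex.isClosed_cellFrontier.union <| isClosed_biUnion_finset fun m _ =>
      isClosed_biUnion_finset fun j _ => RelCWComplex.isClosed_closedCell
  have hRd : ∀ y ∈ R, y ∉ RelCWComplex.openCell k β := by
    rintro y (hy | hy) hyo
    · exact Set.disjoint_left.1 (RelCWComplex.disjoint_skeletonLT_openCell (le_refl _))
        (RelCWComplex.cellFrontier_subset_skeletonLT k β hy) hyo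
    · simp only [Set.mem_iUnion, Finset.mem_filter, Finset.mem_range] at hy
      obtain ⟨m, hm, j, ⟨_, hne⟩, hyj⟩ := hy
      exact Set.disjoint_left.1 (disjoint_openCell hm hne) hyj hyo
  have hcov : ∀ s : Sph k, RelCWComplex.map (k + 1) α s ∈ R ∨
      RelCWComplex.map (k + 1) α s ∈ RelCWComplex.openCell k β := by
    intro s
    have hs : RelCWComplex.map (k + 1) α s ∈ RelCWComplex.cellFrontier (k + 1) α :=
      Set.mem_image_of_mem _ s.2
    have h := hI hs
    simp only [Set.mem_iUnion] at h
    obtain ⟨m, hm, j, hj, hmem⟩ := h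
    by_cases hne : (⟨m, j⟩ : Σ n, RelCWComplex.cell C n) = ⟨k, β⟩
    · cases hne
      rw [← RelCWComplex.cellFrontier_union_openCell_eq_closedCell] at hmem
      rcases hmem with h | h
      · exact Or.inl (Or.inl h)
      · exact Or.inr h
    · refine Or.inl (Or.inr ?_)
      simp only [Set.mem_iUnion, Finset.mem_filter, Finset.mem_range]
      exact ⟨m, hm, j, ⟨hj, hne⟩, hmem⟩
  refine continuous_iff_isClosed.2 fun A hA => ?_
  have hK : IsClosed (RelCWComplex.map k β '' (closedBall 0 1 ∩ collapse ⁻¹' A)) := by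
    refine IsCompact.isClosed (IsCompact.image_of_continuousOn ?_
      ((RelCWComplex.continuousOn k β).mono Set.inter_subset_left))
    exact (isCompact_closedBall _ _).inter_right (hA.preimage continuous_collapse)
  have hsub : ∀ s : Sph k, RelCWComplex.map (k + 1) α s ∈
      RelCWComplex.map k β '' (closedBall 0 1 ∩ collapse ⁻¹' A) →
      cellQuotient β (RelCWComplex.map (k + 1) α s) ∈ A := by
    rintro s ⟨x, ⟨hx, hxA⟩, hxs⟩
    rw [← hxs, cellQuotient_map β hx]
    exact hxA
  have hopen : ∀ s : Sph k, RelCWComplex.map (k + 1) α s ∈ RelCWComplex.openCell k β →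
      cellQuotient β (RelCWComplex.map (k + 1) α s) ∈ A →
      RelCWComplex.map (k + 1) α s ∈
        RelCWComplex.map k β '' (closedBall 0 1 ∩ collapse ⁻¹' A) := by
    rintro s ⟨x, hx, hxs⟩ hA'
    have hx' := ball_subset_closedBall hx
    rw [← hxs, cellQuotient_map β hx'] at hA'
    exact ⟨x, ⟨hx', hA'⟩, hxs⟩
  by_cases hb : basePt k ∈ A
  · convert (hK.union hRc).preimage hφ using 1
    ext s
    simp only [Set.mem_preimage, Set.mem_union]
    constructor
    · intro h
      rcases hcov s with h' | h'
      · exact Or.inr h'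
      · exact Or.inl (hopen s h' h)
    · rintro (h | h)
      · exact hsub s h
      · rw [cellQuotient, if_neg (hRd _ h)]
        exact hb
  · convert hK.preimage hφ using 1
    ext s
    simp only [Set.mem_preimage]
    refine ⟨fun h => ?_, hsub s⟩
    rcases hcov s with h' | h'
    · rw [cellQuotient, if_neg (hRd _ h')] at h
      exact absurd h hb
    · exact hopen s h' h

/-- The incidence number `d_{αβ}` of a `(k+1)`-cell `α` and a `k`-cell `β`. -/
def incidence [T2Space X] {k : ℕ} (α : RelCWComplex.cell C (k + 1))
    (β : RelCWComplex.cell C k) : ℤ :=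
  degree ⟨fun s : Sph k => cellQuotient β (RelCWComplex.map (k + 1) α s),
    continuous_attaching α β⟩

/-- The boundary of a cell meets only finitely many cells, so a cell has only finitely many faces
of non-zero incidence number. -/
theorem finite_incidence [T2Space X] {k : ℕ} (α : RelCWComplex.cell C (k + 1)) :
    {β : RelCWComplex.cell C k | incidence α β ≠ 0}.Finite := by
  obtain ⟨I, hI⟩ := CWComplex.cellFrontier_subset_finite_closedCell (k + 1) α
  refine (I k).finite_toSet.subset fun β hβ => ?_
  by_contra hn
  refine hβ ?_
  have hc : (⟨fun s : Sph k => cellQuotient β (RelCWComplex.map (k + 1) α s),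
      continuous_attaching α β⟩ : C(Sph k, Sph k)) = ContinuousMap.const _ (basePt k) := by
    ext1 s
    have hs : RelCWComplex.map (k + 1) α s ∈ RelCWComplex.cellFrontier (k + 1) α :=
      Set.mem_image_of_mem _ s.2
    have h := hI hs
    simp only [Set.mem_iUnion] at h
    obtain ⟨m, hm, j, hj, hmem⟩ := h
    have hne : (⟨m, j⟩ : Σ n, RelCWComplex.cell C n) ≠ ⟨k, β⟩ := by
      intro he
      cases he
      exact hn hj
    exact if_neg (Set.disjoint_left.1 (disjoint_openCell hm hne) hmem)
  rw [incidence, hc, degree_const]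

/-- Each cell is a face, with non-zero incidence number, of only finitely many cells. -/
class LocallyFiniteIncidence (C : Set X) [CWComplex C] [T2Space X] : Prop where
  finite_cofaces : ∀ (k : ℕ) (β : RelCWComplex.cell C k),
    {α : RelCWComplex.cell C (k + 1) | incidence α β ≠ 0}.Finite

end CW

/-- An integer matrix, with rows indexed by `A` and columns indexed by `B`, that has only finitely
many non-zero entries in each row and in each column. -/
structure IncidenceMatrix (A B : Type*) where
  /-- The entries. -/
  coeff : A → B → ℤ
  finite_row : ∀ α, {β | coeff α β ≠ 0}.Finite
  finite_col : ∀ β, {α | coeff α β ≠ 0}.Finite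

section CWMatrices

variable {X : Type*} [TopologicalSpace X] [T2Space X] (C : Set X) [CWComplex C]

/-- The cells of dimension `n - 1` (there are none for `n = 0`). -/
def LowerCell : ℕ → Type _
  | 0 => PEmpty
  | k + 1 => RelCWComplex.cell C k

/-- The incidence numbers of the `(n+1)`-cells and the `n`-cells. -/
def upperIncidence [LocallyFiniteIncidence C] (n : ℕ) :
    IncidenceMatrix (RelCWComplex.cell C (n + 1)) (RelCWComplex.cell C n) where
  coeff := incidence
  finite_row := finite_incidence
  finite_col := LocallyFiniteIncidence.finite_cofaces n

/-- The incidence numbers of the `n`-cells and the `(n-1)`-cells. -/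
def lowerIncidence [LocallyFiniteIncidence C] :
    (n : ℕ) → IncidenceMatrix (RelCWComplex.cell C n) (LowerCell C n)
  | 0 => ⟨fun _ β => PEmpty.elim β, fun _ => Set.toFinite (α := PEmpty) _, fun β => PEmpty.elim β⟩
  | k + 1 => upperIncidence C k

end CWMatrices

namespace IncidenceMatrix

variable {A B M : Type*} [AddCommGroup M] (D : IncidenceMatrix A B)

/-- The boundary `∂` on locally finite chains. The sums are finite because the columns are. -/
def boundary (c : A → M) : B → M := fun β => ∑ᶠ α, D.coeff α β • c α

/-- The coboundary `∂ᵀ` on cochains. The sums are finite because the rows are. -/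
def coboundary (c : B → M) : A → M := fun α => ∑ᶠ β, D.coeff α β • c β

/-- The restriction of `∂` to chains (of finite support). -/
def boundaryFin (c : A →₀ M) : B →₀ M :=
  Finsupp.ofSupportFinite (D.boundary c) <| by
    refine (c.support.finite_toSet.biUnion fun α _ => D.finite_row α).subset fun β hβ => ?_
    obtain ⟨α, hα⟩ : ∃ α, D.coeff α β • c α ≠ 0 := by
      by_contra! h0
      exact hβ (finsum_eq_zero_of_forall_eq_zero h0)
    simp only [Set.mem_iUnion]
    refine ⟨α, Finsupp.mem_support_iff.2 fun h => hα (by rw [h, smul_zero]), fun h => hα ?_⟩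
    rw [h, zero_smul]

/-- The restriction of `∂ᵀ` to locally finite cochains (those of finite support). -/
def coboundaryFin (c : B →₀ M) : A →₀ M :=
  Finsupp.ofSupportFinite (D.coboundary c) <| by
    refine (c.support.finite_toSet.biUnion fun β _ => D.finite_col β).subset fun α hα => ?_
    obtain ⟨β, hβ⟩ : ∃ β, D.coeff α β • c β ≠ 0 := by
      by_contra! h0
      exact hα (finsum_eq_zero_of_forall_eq_zero h0)
    simp only [Set.mem_iUnion]
    refine ⟨β, Finsupp.mem_support_iff.2 fun h => hβ (by rw [h, smul_zero]), fun h => hβ ?_⟩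
    rw [h, zero_smul]

end IncidenceMatrix

/-- The part `c_K` of a chain or cochain supported in the finite set `K`. -/
def restrict {A M : Type*} [AddCommGroup M] (c : A → M) (K : Finset A) : A →₀ M :=
  Finsupp.indicator K fun α _ => c α

/-- The dual `Ĝ = Hom(G, ℚ/ℤ)`. -/
abbrev DualGroup (G : Type*) [AddCommGroup G] : Type _ := G →+ AddCircle (1 : ℚ)

instance {G : Type*} [AddCommGroup G] [Finite G] : Finite (DualGroup G) := by
  have hn : 0 < Nat.card G := Nat.card_pos
  have : Finite {u : AddCircle (1 : ℚ) | Nat.card G • u = 0} := AddCircle.finite_torsion 1 hn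
  refine Finite.of_injective (fun χ : DualGroup G => fun g =>
    (⟨χ g, by simp [← map_nsmul]⟩ : {u : AddCircle (1 : ℚ) | Nat.card G • u = 0})) ?_
  intro χ ψ h
  ext g
  exact congrArg Subtype.val (congrFun h g)

/-- The pairing `∑ α, χ_α(g_α)` of a `Ĝ`-valued chain and a `G`-valued cochain, whenever their
supports have a finite intersection (otherwise it is not meaningful). -/
def pairing {S G : Type*} [AddCommGroup G] (b : S → DualGroup G) (a : S → G) : AddCircle (1 : ℚ) :=
  ∑ᶠ s, b s (a s)

theorem periodic_exp_rat :
    Function.Periodic (fun q : ℚ => Complex.exp (2 * Real.pi * Complex.I * (q : ℂ))) 1 := by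
  intro q
  simp only [Rat.cast_add, Rat.cast_one, mul_add, mul_one]
  exact Complex.exp_periodic _

/-- The function `x ↦ e^{2πix}` on `ℚ/ℤ`. -/
def phase (x : AddCircle (1 : ℚ)) : ℂ := periodic_exp_rat.lift x

theorem phase_add (x y : AddCircle (1 : ℚ)) : phase (x + y) = phase x * phase y := by
  induction x using QuotientAddGroup.induction_on
  induction y using QuotientAddGroup.induction_on
  rename_i p q
  change Complex.exp (2 * Real.pi * Complex.I * ((p + q : ℚ) : ℂ)) =
    Complex.exp (2 * Real.pi * Complex.I * (p : ℂ)) *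
      Complex.exp (2 * Real.pi * Complex.I * (q : ℂ))
  rw [← Complex.exp_add]
  push_cast
  ring_nf

theorem norm_phase (x : AddCircle (1 : ℚ)) : ‖phase x‖ = 1 := by
  induction x using QuotientAddGroup.induction_on
  rename_i p
  change ‖Complex.exp (2 * Real.pi * Complex.I * (p : ℂ))‖ = 1
  have : 2 * Real.pi * Complex.I * (p : ℂ) = ((2 * Real.pi * p : ℝ) : ℂ) * Complex.I := by
    push_cast
    ring
  rw [this, Complex.norm_exp_ofReal_mul_I]

section Algebra

variable (S G : Type*)

/-- The Hilbert space `ℓ²(G^S)` with orthonormal basis indexed by the configurations `S → G`. For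
each finite `Λ ⊆ S` it is the tensor product of `ℓ²(G^Λ) = ⨂_Λ ℓ²(G)` and `ℓ²(G^(S ∖ Λ))`. -/
abbrev ConfigSpace : Type _ := lp (fun _ : S → G => ℂ) 2

variable {S G}

open Classical in
/-- The configuration that agrees with `k` on `Λ` and with `h` elsewhere. -/
def glue (Λ : Finset S) (h : S → G) (k : Λ → G) : S → G :=
  fun s => if hs : s ∈ Λ then k ⟨s, hs⟩ else h s

/-- `T = A ⊗ 1` for an operator `A` on `ℓ²(G^Λ)`, given by its matrix in the standard basis. -/
def IsLocalOn (Λ : Finset S) (T : ConfigSpace S G →L[ℂ] ConfigSpace S G) : Prop :=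
  ∃ A : Matrix (Λ → G) (Λ → G) ℂ, ∀ (ψ : ConfigSpace S G) (h : S → G),
    (T ψ) h = ∑ᶠ k : Λ → G, A (fun s => h s) k * ψ (glue Λ h k)

variable (S G)

/-- The quasi-local algebra, the C*-inductive limit of the algebras `B(ℓ²(G^Λ))` for `Λ ⊆ S` finite
along `A ↦ A ⊗ 1`: it is realized as the norm closure of the algebra of all local operators
`A ⊗ 1` on `ℓ²(G^S)`. -/
def quasiLocal : StarSubalgebra ℂ (ConfigSpace S G →L[ℂ] ConfigSpace S G) :=
  (StarAlgebra.adjoin ℂ {T | ∃ Λ : Finset S, IsLocalOn Λ T}).topologicalClosure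

/-- The elements of the quasi-local algebra, as a type. -/
abbrev QuasiLocal : Type _ := quasiLocal S G

variable {S G}

theorem IsLocalOn.mem {Λ : Finset S} {T : ConfigSpace S G →L[ℂ] ConfigSpace S G}
    (hT : IsLocalOn Λ T) : T ∈ quasiLocal S G :=
  StarSubalgebra.le_topologicalClosure _ (StarAlgebra.subset_adjoin ℂ _ ⟨Λ, hT⟩)

/-- The operator `(Tψ)(h) = u(h) ψ(e(h))` on `ℓ²(I)`, for a permutation `e` and phases `u`. -/
def phasePerm {I : Type*} (e : I ≃ I) (u : I → ℂ) (hu : ∀ h, ‖u h‖ = 1) :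
    lp (fun _ : I => ℂ) 2 →L[ℂ] lp (fun _ : I => ℂ) 2 :=
  have hmem : ∀ ψ : lp (fun _ : I => ℂ) 2, Memℓp (fun h => u h * ψ (e h)) 2 := fun ψ => by
    have h2 : (0 : ℝ) < (2 : ENNReal).toReal := by norm_num
    have := e.summable_iff.2 ((lp.memℓp ψ).summable h2)
    refine memℓp_gen (this.congr fun h => ?_)
    rw [norm_mul, hu, one_mul]
    rfl
  LinearMap.mkContinuous
    { toFun := fun ψ => ⟨fun h => u h * ψ (e h), hmem ψ⟩
      map_add' := fun ψ φ => by
        ext h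
        exact mul_add _ _ _
      map_smul' := fun c ψ => by
        ext h
        exact mul_left_comm _ _ _ } 1 fun ψ => by
    have h2 : (0 : ℝ) < (2 : ENNReal).toReal := by norm_num
    rw [one_mul, lp.norm_eq_tsum_rpow h2, lp.norm_eq_tsum_rpow h2]
    refine le_of_eq ?_
    congr 1
    rw [← e.tsum_eq fun h => ‖ψ h‖ ^ (2 : ENNReal).toReal]
    refine tsum_congr fun h => ?_
    change ‖u h * ψ (e h)‖ ^ _ = _
    rw [norm_mul, hu, one_mul]

theorem phasePerm_apply {I : Type*} (e : I ≃ I) (u : I → ℂ) (hu : ∀ h, ‖u h‖ = 1)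
    (ψ : lp (fun _ : I => ℂ) 2) (h : I) : phasePerm e u hu ψ h = u h * ψ (e h) := rfl

variable [AddCommGroup G]

/-- `X^a`, which sends the basis vector `|h⟩` to `|a + h⟩`. -/
def pauliX (a : S →₀ G) : QuasiLocal S G :=
  ⟨phasePerm (Equiv.subRight (a : S → G)) (fun _ => 1) fun _ => norm_one, by
    classical
    refine IsLocalOn.mem (Λ := a.support)
      ⟨fun j k => if k = (fun s => j s - a s) then 1 else 0, fun ψ h => ?_⟩
    have hg : glue a.support h (fun s => h s - a s) = h - a := by
      funext s
      by_cases hs : s ∈ a.support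
      · simp [glue, hs]
      · simp [glue, hs, Finsupp.notMem_support_iff.1 hs]
    rw [phasePerm_apply, finsum_eq_single _ (fun s : a.support => h s - a s)]
    · simp only [if_true, hg]
      rfl
    · intro k hk
      exact mul_eq_zero_of_left (if_neg hk) _⟩

/-- `Z^b`, which multiplies the basis vector `|h⟩` by `∏ s, e^{2πi b_s(h_s)}`. -/
def pauliZ (b : S →₀ DualGroup G) : QuasiLocal S G :=
  ⟨phasePerm (Equiv.refl _) (fun h => phase (∑ s ∈ b.support, b s (h s)))
      fun _ => norm_phase _, by
    classical
    refine IsLocalOn.mem (Λ := b.support)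
      ⟨fun j k => if k = j then phase (∑ s : b.support, b s (j s)) else 0, fun ψ h => ?_⟩
    have hg : glue b.support h (fun s => h s) = h := by
      funext s
      simp [glue]
    rw [phasePerm_apply, finsum_eq_single _ (fun s : b.support => h s)]
    · simp only [if_true, hg, Finset.sum_coe_sort b.support fun s => b s (h s)]
      rfl
    · intro k hk
      exact mul_eq_zero_of_left (if_neg hk) _⟩

open Filter Topology

/-- The automorphism `ρ_γ(A) = lim_K Z^{γ_K} A Z^{-γ_K}` (a limit in norm). -/
def rhoZ (γ : S → DualGroup G) (A : QuasiLocal S G) : QuasiLocal S G :=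
  limUnder atTop fun K : Finset S => pauliZ (restrict γ K) * A * pauliZ (-restrict γ K)

/-- The automorphism `ρ_δ(A) = lim_K X^{δ_K} A X^{-δ_K}` (a limit in norm). -/
def rhoX (δ : S → G) (A : QuasiLocal S G) : QuasiLocal S G :=
  limUnder atTop fun K : Finset S => pauliX (restrict δ K) * A * pauliX (-restrict δ K)

/-- The endomorphism `ρ_{(γ,δ)} = ρ_γ ∘ ρ_δ`. -/
def rho (γ : S → DualGroup G) (δ : S → G) (A : QuasiLocal S G) : QuasiLocal S G :=
  rhoZ γ (rhoX δ A)

end Algebra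

section States

variable {Su S Sl G : Type*} [AddCommGroup G]

open scoped ComplexOrder in
/-- `ω` is a positive and normalized linear functional. -/
def IsState (ω : QuasiLocal S G →ₗ[ℂ] ℂ) : Prop :=
  (∀ A, 0 ≤ ω (star A * A)) ∧ ω 1 = 1

/-- `ω` is an extreme point of the set of all states. -/
def IsPureState (ω : QuasiLocal S G →ₗ[ℂ] ℂ) : Prop :=
  ω ∈ Set.extremePoints ℝ {φ : QuasiLocal S G →ₗ[ℂ] ℂ | IsState φ}

/-- The star operator `A_α = |G|⁻¹ ∑ g, X^{∂ᵀ(g e_α)}`, a projection. -/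
def starOp (Dl : IncidenceMatrix S Sl) (α : Sl) : QuasiLocal S G :=
  (Nat.card G : ℂ)⁻¹ • ∑ᶠ g : G, pauliX (Dl.coboundaryFin (Finsupp.single α g))

/-- The plaquette operator `B_β = |G|⁻¹ ∑ χ, Z^{∂(χ e_β)}`, a projection. -/
def plaquetteOp (Du : IncidenceMatrix Su S) (β : Su) : QuasiLocal S G :=
  (Nat.card G : ℂ)⁻¹ • ∑ᶠ χ : DualGroup G, pauliZ (Du.boundaryFin (Finsupp.single β χ))

/-- `ω` is a frustration free ground state of `H = -∑ A_α - ∑ B_β`: a state that minimizes each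
interaction term `-A_α`, `-B_β`, where `A_α` and `B_β` are projections. -/
structure IsFrustrationFree (Du : IncidenceMatrix Su S) (Dl : IncidenceMatrix S Sl)
    (ω : QuasiLocal S G →ₗ[ℂ] ℂ) : Prop where
  isState : IsState ω
  apply_starOp : ∀ α, ω (starOp Dl α) = 1
  apply_plaquetteOp : ∀ β, ω (plaquetteOp Du β) = 1

/-- `(H, π, Ω)` is the GNS representation of `ω`. It is unique up to unitary equivalence. -/
structure IsGNS {H : Type*} [NormedAddCommGroup H] [InnerProductSpace ℂ H] [CompleteSpace H]
    (ω : QuasiLocal S G →ₗ[ℂ] ℂ) (π : QuasiLocal S G →⋆ₐ[ℂ] (H →L[ℂ] H)) (Ω : H) : Prop where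
  cyclic : Dense (Set.range fun A => π A Ω)
  vector_state : ∀ A, ω A = inner ℂ Ω (π A Ω)

/-- A localized endomorphism `ρ_{(γ,δ)}` (that is, `∂γ` and `∂ᵀδ` have finite support) together with
the data `(γ̂, δ̂, p, q)` that define a charge transporter. -/
structure TransportData (Du : IncidenceMatrix Su S) (Dl : IncidenceMatrix S Sl) (G : Type*)
    [AddCommGroup G] where
  γ : S → DualGroup G
  δ : S → G
  finite_boundary : (Function.support (Dl.boundary γ)).Finite
  finite_coboundary : (Function.support (Du.coboundary δ)).Finite
  γhat : S →₀ DualGroup G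
  δhat : S →₀ G
  p : Su → DualGroup G
  q : Sl → G

namespace TransportData

variable {Du : IncidenceMatrix Su S} {Dl : IncidenceMatrix S Sl}

/-- The unitaries `U_{K₊,K₋} = Z^{-γ̂} X^{-δ̂} X^{∂ᵀ(q_{K₋})} Z^{∂(p_{K₊})}`. -/
def net (T : TransportData Du Dl G) (K : Finset Su × Finset Sl) : QuasiLocal S G :=
  pauliZ (-T.γhat) * pauliX (-T.δhat) * pauliX (Dl.coboundaryFin (restrict T.q K.2)) *
    pauliZ (Du.boundaryFin (restrict T.p K.1))

/-- The terms `⟨γ₂,δ̂₁⟩ + ⟨γ̂₂,δ₁⟩ - ⟨γ̂₂,δ̂₁⟩ + ⟨∂γ̂₂,q₁⟩ - ⟨∂γ₂,q₁⟩ + ⟨p₂,∂ᵀδ̂₁⟩ - ⟨p₂,∂ᵀδ₁⟩`. In each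
pairing at least one of the two arguments has finite support. -/
def braidingTerms (T₁ T₂ : TransportData Du Dl G) : AddCircle (1 : ℚ) :=
  pairing T₂.γ T₁.δhat + pairing T₂.γhat T₁.δ - pairing T₂.γhat T₁.δhat
    + pairing (Dl.boundary T₂.γhat) T₁.q - pairing (Dl.boundary T₂.γ) T₁.q
    + pairing T₂.p (Du.coboundary T₁.δhat) - pairing T₂.p (Du.coboundary T₁.δ)

end TransportData

/-- Convergence of a net of bounded operators in the strong operator topology. -/
def StrongTendsto {I H : Type*} [Preorder I] [NormedAddCommGroup H] [InnerProductSpace ℂ H]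
    (F : I → H →L[ℂ] H) (L : H →L[ℂ] H) : Prop :=
  ∀ v : H, Filter.Tendsto (fun i => F i v) Filter.atTop (nhds (L v))

end States

end CellModel

end

/-! Each unitary of the net splits as `net = stringOp * stabilizerNet`: a fixed Weyl operator times
X^{∂ᵀ(q_{K₋})} Z^{∂(p_{K₊})}. The second factor is a product of the unitaries averaged in the star
and plaquette operators. An average of unitaries has expectation 1 only if every one of them fixes
the GNS vector Ω, so the second factor fixes Ω (`IsGNS.apply_eq_of_average`).

Moving the second factor past Z^b X^a costs the phase with exponent ⟨p_{K₊}, ∂ᵀa⟩ - ⟨∂b, q_{K₋}⟩. By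
local finiteness ∂ᵀa and ∂b have finite support, so this exponent is eventually constant
(`eventually_stabilizerNet_mul`). Hence the net is eventually constant on each vector Z^b X^a Ω.
These vectors span a dense subspace, because Fourier inversion on G^Λ writes every local operator in
Weyl operators (`dense_weylSpan`). As the net is bounded by 1, it converges strongly everywhere, and
so do its adjoints (`exists_strongTendsto_stabilizerNet`).

The limits V₁, V₂ are isometries, have the vectors Z^b X^a Ω as common eigenvectors and hence
commute, and they commute with Weyl operators up to phases. So U₁U₂ = c U₂U₁ with an explicit phase
c (`transporter_mul_comm`).

Finally, a Weyl operator is an eigenvector of ρ_{(γ,δ)} (`IsWeyl.rho_eq`). On the net the eigenvalue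
is eventually constant because ∂γ and ∂ᵀδ have finite support (`eventually_pairing_net`). The
braiding net therefore tends to a phase times U₁*U₂*U₁U₂ = c, and adding the exponents gives θ₁₂ -
θ₂₁ (`braidingTerms_sub`). -/

noncomputable section

namespace CellModel

/-! ### The phase function and bilinearity of the pairing. -/

section Pairing

variable {S Su Sl G : Type*} [AddCommGroup G]

theorem phase_zero : phase 0 = 1 := by
  change Complex.exp (2 * Real.pi * Complex.I * ((0 : ℚ) : ℂ)) = 1
  simp

theorem phase_neg (x : AddCircle (1 : ℚ)) : phase (-x) = star (phase x) := by
  have h : phase x * phase (-x) = 1 := by rw [← phase_add, add_neg_cancel, phase_zero]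
  have h' : phase x * star (phase x) = 1 := by
    rw [Complex.star_def, Complex.mul_conj, Complex.normSq_eq_norm_sq, norm_phase]
    simp
  have h0 : phase x ≠ 0 := left_ne_zero_of_mul_eq_one h
  exact mul_left_cancel₀ h0 (h.trans h'.symm)

theorem phase_mul_neg (x : AddCircle (1 : ℚ)) : phase x * phase (-x) = 1 := by
  rw [← phase_add, add_neg_cancel, phase_zero]

/-- Faithfulness of the phase on ℚ/ℤ: it turns a non-trivial character into a non-constant phase, as
the orthogonality relations need. -/
theorem phase_eq_one_iff {x : AddCircle (1 : ℚ)} : phase x = 1 ↔ x = 0 := by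
  refine ⟨fun h => ?_, fun h => h ▸ phase_zero⟩
  induction x using QuotientAddGroup.induction_on
  rename_i q
  change Complex.exp (2 * Real.pi * Complex.I * ((q : ℚ) : ℂ)) = 1 at h
  obtain ⟨n, hn⟩ := Complex.exp_eq_one_iff.1 h
  have h2 : (2 * Real.pi * Complex.I : ℂ) ≠ 0 := Complex.two_pi_I_ne_zero
  have hq : (q : ℂ) = (n : ℂ) := mul_left_cancel₀ h2 (by rw [hn]; ring)
  have hq' : q = n := by exact_mod_cast hq
  rw [hq']
  exact (AddCircle.coe_eq_zero_iff (1 : ℚ)).2 ⟨n, by simp⟩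

theorem finite_support_pairing_left (b : S →₀ DualGroup G) (a : S → G) :
    (Function.support fun s => b s (a s)).Finite :=
  b.support.finite_toSet.subset fun s hs => Finsupp.mem_support_iff.2 fun h => hs (by simp [h])

theorem finite_support_pairing_right (b : S → DualGroup G) (a : S →₀ G) :
    (Function.support fun s => b s (a s)).Finite :=
  a.support.finite_toSet.subset fun s hs => Finsupp.mem_support_iff.2 fun h => hs (by simp [h])

theorem pairing_eq_sum (b : S →₀ DualGroup G) (a : S → G) :
    pairing b a = ∑ s ∈ b.support, b s (a s) :=
  finsum_eq_sum_of_support_subset _ fun s hs =>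
    Finsupp.mem_support_iff.2 fun h => hs (by simp [h])

theorem pairing_add_left (b b' : S →₀ DualGroup G) (a : S → G) :
    pairing (b + b' : S →₀ DualGroup G) a = pairing b a + pairing b' a := by
  unfold pairing
  rw [← finsum_add_distrib (finite_support_pairing_left b a) (finite_support_pairing_left b' a)]
  rfl

theorem pairing_add_right (b : S → DualGroup G) (a a' : S →₀ G) :
    pairing b (a + a' : S →₀ G) = pairing b a + pairing b a' := by
  unfold pairing
  rw [← finsum_add_distrib (finite_support_pairing_right b a) (finite_support_pairing_right b a')]
  simp

theorem pairing_add_right_fun (b : S →₀ DualGroup G) (a a' : S → G) :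
    pairing b (a + a') = pairing b a + pairing b a' := by
  unfold pairing
  rw [← finsum_add_distrib (finite_support_pairing_left b a) (finite_support_pairing_left b a')]
  simp

theorem pairing_neg_left (b : S → DualGroup G) (a : S → G) :
    pairing (-b) a = -pairing b a := by
  unfold pairing
  rw [← finsum_neg_distrib]
  rfl

theorem pairing_neg_right (b : S → DualGroup G) (a : S → G) :
    pairing b (-a) = -pairing b a := by
  unfold pairing
  rw [← finsum_neg_distrib]
  simp

theorem restrict_apply {A M : Type*} [AddCommGroup M] {c : A → M} {K : Finset A} {s : A}
    (hs : s ∈ K) : restrict c K s = c s := by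
  exact Finsupp.indicator_of_mem hs _

open Filter

/-- If the cochain has finite support, restricting the chain does not change the pairing
eventually. -/
theorem eventually_pairing_restrict_left (b : S → DualGroup G) {a : S → G}
    (ha : (Function.support a).Finite) :
    ∀ᶠ K : Finset S in atTop, pairing (restrict b K) a = pairing b a := by
  filter_upwards [eventually_ge_atTop ha.toFinset] with K hK
  refine finsum_congr fun s => ?_
  by_cases hs : a s = 0
  · simp [hs]
  · rw [restrict_apply (hK (ha.mem_toFinset.2 hs))]

theorem eventually_pairing_restrict_right {b : S → DualGroup G} (a : S → G)
    (hb : (Function.support b).Finite) :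
    ∀ᶠ K : Finset S in atTop, pairing b (restrict a K) = pairing b a := by
  filter_upwards [eventually_ge_atTop hb.toFinset] with K hK
  refine finsum_congr fun s => ?_
  by_cases hs : b s = 0
  · simp [hs]
  · rw [restrict_apply (hK (hb.mem_toFinset.2 hs))]

end Pairing

/-! ### Additivity and adjointness of the boundary and coboundary maps. -/

namespace IncidenceMatrix

variable {A B M G : Type*} [AddCommGroup M] [AddCommGroup G] (D : IncidenceMatrix A B)

theorem finite_support_boundary_summand (c : A → M) (β : B) :
    (Function.support fun α => D.coeff α β • c α).Finite :=
  (D.finite_col β).subset fun α hα h => hα (by simp [h])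

theorem finite_support_coboundary_summand (c : B → M) (α : A) :
    (Function.support fun β => D.coeff α β • c β).Finite :=
  (D.finite_row α).subset fun β hβ h => hβ (by simp [h])

@[simp]
theorem coe_boundaryFin (c : A →₀ M) : (D.boundaryFin c : B → M) = D.boundary c := rfl

@[simp]
theorem coe_coboundaryFin (c : B →₀ M) : (D.coboundaryFin c : A → M) = D.coboundary c := rfl

theorem boundary_neg (c : A → M) : D.boundary (-c) = -D.boundary c := by
  funext β
  simp [boundary, finsum_neg_distrib]

theorem coboundary_neg (c : B → M) : D.coboundary (-c) = -D.coboundary c := by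
  funext β
  simp [coboundary, finsum_neg_distrib]

theorem boundaryFin_zero : D.boundaryFin (0 : A →₀ M) = 0 := by
  ext β
  simp [boundary]

theorem coboundaryFin_zero : D.coboundaryFin (0 : B →₀ M) = 0 := by
  ext β
  simp [coboundary]

theorem boundaryFin_add (c c' : A →₀ M) :
    D.boundaryFin (c + c') = D.boundaryFin c + D.boundaryFin c' := by
  ext β
  simp only [coe_boundaryFin, Finsupp.add_apply, boundary, smul_add]
  exact finsum_add_distrib (D.finite_support_boundary_summand _ β)
    (D.finite_support_boundary_summand _ β)

theorem coboundaryFin_add (c c' : B →₀ M) :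
    D.coboundaryFin (c + c') = D.coboundaryFin c + D.coboundaryFin c' := by
  ext β
  simp only [coe_coboundaryFin, Finsupp.add_apply, coboundary, smul_add]
  exact finsum_add_distrib (D.finite_support_coboundary_summand _ β)
    (D.finite_support_coboundary_summand _ β)

theorem boundary_apply_eq_sum (b : A →₀ M) (β : B) :
    D.boundary b β = ∑ α ∈ b.support, D.coeff α β • b α :=
  finsum_eq_sum_of_support_subset _ fun s hs =>
    Finsupp.mem_support_iff.2 fun h => hs (by simp [h])

theorem coboundary_apply_eq_sum (a : B →₀ M) (α : A) :
    D.coboundary a α = ∑ β ∈ a.support, D.coeff α β • a β :=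
  finsum_eq_sum_of_support_subset _ fun s hs =>
    Finsupp.mem_support_iff.2 fun h => hs (by simp [h])

/-- The boundary is adjoint to the coboundary, for a chain of finite support. -/
theorem pairing_boundary (b : A →₀ DualGroup G) (a : B → G) :
    pairing (D.boundary b) a = pairing b (D.coboundary a) := by
  rw [pairing_eq_sum]
  unfold pairing
  have h : ∀ β, D.boundary (⇑b) β (a β) = ∑ α ∈ b.support, D.coeff α β • b α (a β) := fun β => by
    rw [boundary_apply_eq_sum, AddMonoidHom.finsetSum_apply]
    rfl
  -- The sum over α is finite because `b` has finite support; for each such α only finitely many β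
  -- contribute, because the rows of the matrix are finite. This justifies exchanging the sums.
  rw [finsum_congr h, finsum_sum_comm]
  · refine Finset.sum_congr rfl fun α _ => ?_
    rw [coboundary, AddMonoidHom.map_finsum _ (D.finite_support_coboundary_summand a α)]
    exact finsum_congr fun β => (map_zsmul _ _ _).symm
  · intro α _
    exact (D.finite_row α).subset fun β hβ h => hβ (by simp [h])

/-- The boundary is adjoint to the coboundary, for a cochain of finite support. -/
theorem pairing_coboundary (b : A → DualGroup G) (a : B →₀ G) :
    pairing b (D.coboundary a) = pairing (D.boundary b) a := by
  have h0 : pairing (D.boundary b) a = ∑ β ∈ a.support, D.boundary b β (a β) :=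
    finsum_eq_sum_of_support_subset _ fun s hs =>
      Finsupp.mem_support_iff.2 fun h => hs (by simp [h])
  rw [h0]
  unfold pairing
  have h : ∀ α, b α (D.coboundary (⇑a) α) = ∑ β ∈ a.support, D.coeff α β • b α (a β) := fun α => by
    rw [coboundary_apply_eq_sum, map_sum]
    exact Finset.sum_congr rfl fun β _ => map_zsmul _ _ _
  rw [finsum_congr h, finsum_sum_comm]
  · refine Finset.sum_congr rfl fun β _ => ?_
    change _ = AddMonoidHom.eval (a β) (D.boundary b β)
    rw [boundary, AddMonoidHom.map_finsum _ (D.finite_support_boundary_summand b β)]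
    exact finsum_congr fun α => rfl
  · intro β _
    exact (D.finite_col β).subset fun α hα h => hα (by simp [h])

end IncidenceMatrix

/-! ### Weyl operators, their commutation relations and the action of ρ on them. -/

section Weyl

variable {S G : Type*}

theorem quasiLocal_ext {A B : QuasiLocal S G}
    (h : ∀ (ψ : ConfigSpace S G) (k : S → G),
      (A : ConfigSpace S G →L[ℂ] ConfigSpace S G) ψ k =
        (B : ConfigSpace S G →L[ℂ] ConfigSpace S G) ψ k) : A = B := by
  apply Subtype.ext
  ext ψ k
  exact h ψ k

theorem coe_mul_apply (A B : QuasiLocal S G) (ψ : ConfigSpace S G) :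
    ((A * B : QuasiLocal S G) : ConfigSpace S G →L[ℂ] ConfigSpace S G) ψ =
      (A : ConfigSpace S G →L[ℂ] ConfigSpace S G)
        ((B : ConfigSpace S G →L[ℂ] ConfigSpace S G) ψ) := rfl

theorem coe_smul_apply (c : ℂ) (A : QuasiLocal S G) (ψ : ConfigSpace S G) (h : S → G) :
    ((c • A : QuasiLocal S G) : ConfigSpace S G →L[ℂ] ConfigSpace S G) ψ h =
      c * (A : ConfigSpace S G →L[ℂ] ConfigSpace S G) ψ h := rfl

variable [AddCommGroup G]

theorem coe_pauliX_apply (a : S →₀ G) (ψ : ConfigSpace S G) (h : S → G) :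
    ((pauliX a : QuasiLocal S G) : ConfigSpace S G →L[ℂ] ConfigSpace S G) ψ h = ψ (h - a) := by
  exact (phasePerm_apply _ _ (fun _ => norm_one) ψ h).trans (one_mul _)

theorem coe_pauliZ_apply (b : S →₀ DualGroup G) (ψ : ConfigSpace S G) (h : S → G) :
    ((pauliZ b : QuasiLocal S G) : ConfigSpace S G →L[ℂ] ConfigSpace S G) ψ h =
      phase (pairing b h) * ψ h := by
  rw [pairing_eq_sum]
  rfl

theorem pauliX_zero : (pauliX 0 : QuasiLocal S G) = 1 :=
  quasiLocal_ext fun ψ h => by rw [coe_pauliX_apply]; simp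

theorem pauliZ_zero : (pauliZ 0 : QuasiLocal S G) = 1 :=
  quasiLocal_ext fun ψ h => by rw [coe_pauliZ_apply, pairing_eq_sum]; simp [phase_zero]

theorem pauliX_add (a a' : S →₀ G) : pauliX (a + a') = pauliX a * pauliX a' :=
  quasiLocal_ext fun ψ h => by
    simp only [coe_mul_apply, coe_pauliX_apply, Finsupp.coe_add, sub_sub]

theorem pauliZ_add (b b' : S →₀ DualGroup G) : pauliZ (b + b') = pauliZ b * pauliZ b' :=
  quasiLocal_ext fun ψ h => by
    simp only [coe_mul_apply, coe_pauliZ_apply, pairing_add_left, phase_add, mul_assoc]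

/-- Z^b multiplies by a character of the configuration and X^a translates the configuration by a;
the two orders differ by the value of the character at a. -/
theorem pauliZ_mul_pauliX (b : S →₀ DualGroup G) (a : S →₀ G) :
    pauliZ b * pauliX a = phase (pairing b a) • (pauliX a * pauliZ b) :=
  quasiLocal_ext fun ψ h => by
    simp only [coe_mul_apply, coe_smul_apply, coe_pauliZ_apply, coe_pauliX_apply]
    rw [← mul_assoc, ← phase_add, ← pairing_add_right_fun, add_sub_cancel]

theorem star_pauliX (a : S →₀ G) : star (pauliX a) = pauliX (-a) := by
  apply Subtype.ext
  change ContinuousLinearMap.adjoint _ = _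
  refine ((ContinuousLinearMap.eq_adjoint_iff _ _).2 fun φ ψ => ?_).symm
  rw [lp.inner_eq_tsum, lp.inner_eq_tsum, ← (Equiv.subRight (a : S → G)).tsum_eq]
  refine tsum_congr fun h => ?_
  rw [coe_pauliX_apply, coe_pauliX_apply]
  simp

theorem star_pauliZ (b : S →₀ DualGroup G) : star (pauliZ b) = pauliZ (-b) := by
  apply Subtype.ext
  change ContinuousLinearMap.adjoint _ = _
  refine ((ContinuousLinearMap.eq_adjoint_iff _ _).2 fun φ ψ => ?_).symm
  rw [lp.inner_eq_tsum, lp.inner_eq_tsum]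
  refine tsum_congr fun h => ?_
  rw [coe_pauliZ_apply, coe_pauliZ_apply, Finsupp.coe_neg, pairing_neg_left, phase_neg]
  simp [mul_assoc, mul_comm]

/-- `A` is a multiple of the Weyl operator `Z^b X^a`. -/
def IsWeyl (A : QuasiLocal S G) (b : S →₀ DualGroup G) (a : S →₀ G) : Prop :=
  ∃ c : ℂ, A = c • (pauliZ b * pauliX a)

theorem isWeyl_pauliX (a : S →₀ G) : IsWeyl (pauliX a) 0 a := ⟨1, by simp [pauliZ_zero]⟩

theorem isWeyl_pauliZ (b : S →₀ DualGroup G) : IsWeyl (pauliZ b) b 0 := ⟨1, by simp [pauliX_zero]⟩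

theorem pauliX_mul_pauliZ (b : S →₀ DualGroup G) (a : S →₀ G) :
    pauliX a * pauliZ b = phase (-pairing b a) • (pauliZ b * pauliX a) := by
  rw [pauliZ_mul_pauliX, smul_smul, mul_comm, phase_mul_neg, one_smul]

theorem IsWeyl.mul {A A' : QuasiLocal S G} {b b' : S →₀ DualGroup G} {a a' : S →₀ G}
    (h : IsWeyl A b a) (h' : IsWeyl A' b' a') : IsWeyl (A * A') (b + b') (a + a') := by
  obtain ⟨c, rfl⟩ := h
  obtain ⟨c', rfl⟩ := h'
  refine ⟨c * c' * phase (-pairing b' a), ?_⟩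
  rw [smul_mul_smul_comm, pauliZ_add, pauliX_add, mul_assoc (pauliZ b) (pauliX a),
    ← mul_assoc (pauliX a), pauliX_mul_pauliZ]
  simp only [smul_mul_assoc, mul_smul_comm, smul_smul, mul_assoc]

theorem IsWeyl.star {A : QuasiLocal S G} {b : S →₀ DualGroup G} {a : S →₀ G}
    (h : IsWeyl A b a) : IsWeyl (star A) (-b) (-a) := by
  obtain ⟨c, rfl⟩ := h
  rw [star_smul, star_mul, star_pauliX, star_pauliZ, pauliX_mul_pauliZ, smul_smul]
  exact ⟨_, rfl⟩

/-- The commutation relations of Weyl operators. -/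
theorem IsWeyl.mul_comm_phase {A A' : QuasiLocal S G} {b b' : S →₀ DualGroup G} {a a' : S →₀ G}
    (h : IsWeyl A b a) (h' : IsWeyl A' b' a') :
    A * A' = phase (pairing b a' - pairing b' a) • (A' * A) := by
  obtain ⟨c, rfl⟩ := h
  obtain ⟨c', rfl⟩ := h'
  -- Both products are brought to the same normal form, Z to the left of X; the commutation phase is
  -- the quotient of the two phases that arise.
  have hl : pauliZ b * pauliX a * (pauliZ b' * pauliX a') =
      phase (-pairing b' a) • (pauliZ (b + b') * pauliX (a + a')) := by
    rw [pauliZ_add, pauliX_add, mul_assoc (pauliZ b) (pauliX a),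
      ← mul_assoc (pauliX a), pauliX_mul_pauliZ]
    simp only [smul_mul_assoc, mul_smul_comm, mul_assoc]
  have hr : pauliZ b' * pauliX a' * (pauliZ b * pauliX a) =
      phase (-pairing b a') • (pauliZ (b + b') * pauliX (a + a')) := by
    rw [add_comm b, add_comm a, pauliZ_add, pauliX_add, mul_assoc (pauliZ b') (pauliX a'),
      ← mul_assoc (pauliX a'), pauliX_mul_pauliZ]
    simp only [smul_mul_assoc, mul_smul_comm, mul_assoc]
  rw [smul_mul_smul_comm, smul_mul_smul_comm, hl, hr, smul_smul, smul_smul, smul_smul]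
  congr 1
  rw [sub_eq_add_neg, phase_add]
  linear_combination (-c * c' * phase (-pairing b' a)) * phase_mul_neg (pairing b a')

theorem pauliX_mul_neg (a : S →₀ G) : pauliX a * pauliX (-a) = 1 := by
  rw [← pauliX_add, add_neg_cancel, pauliX_zero]

theorem pauliZ_mul_neg (b : S →₀ DualGroup G) : pauliZ b * pauliZ (-b) = 1 := by
  rw [← pauliZ_add, ← pauliZ_zero]
  congr 1
  exact add_neg_cancel b

open Filter Topology

/-- Conjugation by X^{δ_K} only multiplies a Weyl operator by a phase, which no longer changes once
K contains the support of b. The norm limit is thus that of an eventually constant net, whatever the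
support of δ. -/
theorem IsWeyl.rhoX_eq {A : QuasiLocal S G} {b : S →₀ DualGroup G} {a : S →₀ G}
    (h : IsWeyl A b a) (δ : S → G) : rhoX δ A = phase (-pairing b δ) • A := by
  refine Tendsto.limUnder_eq (tendsto_nhds_of_eventually_eq ?_)
  filter_upwards [eventually_pairing_restrict_right δ (b := ⇑b) b.hasFiniteSupport] with K hK
  rw [(isWeyl_pauliX _).mul_comm_phase h, smul_mul_assoc, mul_assoc, pauliX_mul_neg, mul_one, hK,
    Finsupp.coe_zero, pairing]
  simp

theorem IsWeyl.rhoZ_eq {A : QuasiLocal S G} {b : S →₀ DualGroup G} {a : S →₀ G}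
    (h : IsWeyl A b a) (γ : S → DualGroup G) : rhoZ γ A = phase (pairing γ a) • A := by
  refine Tendsto.limUnder_eq (tendsto_nhds_of_eventually_eq ?_)
  filter_upwards [eventually_pairing_restrict_left γ (a := ⇑a) a.hasFiniteSupport] with K hK
  rw [(isWeyl_pauliZ _).mul_comm_phase h, smul_mul_assoc, mul_assoc, pauliZ_mul_neg, mul_one, hK,
    Finsupp.coe_zero, pairing, pairing]
  simp

theorem IsWeyl.smul {A : QuasiLocal S G} {b : S →₀ DualGroup G} {a : S →₀ G}
    (h : IsWeyl A b a) (c : ℂ) : IsWeyl (c • A) b a := by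
  obtain ⟨c', rfl⟩ := h
  exact ⟨c * c', smul_smul _ _ _⟩

/-- A Weyl operator is an eigenvector of `ρ_{(γ,δ)}`. -/
theorem IsWeyl.rho_eq {A : QuasiLocal S G} {b : S →₀ DualGroup G} {a : S →₀ G}
    (h : IsWeyl A b a) (γ : S → DualGroup G) (δ : S → G) :
    rho γ δ A = phase (pairing γ a - pairing b δ) • A := by
  rw [rho, h.rhoX_eq, (h.smul _).rhoZ_eq, smul_smul, ← phase_add, sub_eq_add_neg]

end Weyl

/-! ### Character orthogonality and density of the Weyl operators. -/

section Density

variable {S G : Type*} [AddCommGroup G]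

/-- Orthogonality of characters: the sum of a non-trivial character vanishes. -/
theorem sum_phase_eq_zero {J : Type*} [AddCommGroup J] [Fintype J] {f : J →+ AddCircle (1 : ℚ)}
    (hf : f ≠ 0) : ∑ j, phase (f j) = 0 := by
  obtain ⟨i, hi⟩ := DFunLike.ne_iff.1 hf
  -- Translating the summation variable by i multiplies the sum by `phase (f i)`, which is not 1.
  have h := Fintype.sum_equiv (Equiv.addLeft i) (fun j => phase (f (i + j)))
    (fun j => phase (f j)) fun _ => rfl
  simp only [map_add, phase_add, ← Finset.mul_sum] at h
  have hne : phase (f i) - 1 ≠ 0 := sub_ne_zero.2 fun h => hi (phase_eq_one_iff.1 h)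
  refine (mul_eq_zero.1 (?_ : (phase (f i) - 1) * _ = 0)).resolve_left hne
  rw [sub_mul, one_mul, h, sub_self]

theorem exists_dualGroup_apply_ne_zero {g : G} (hg : g ≠ 0) : ∃ χ : DualGroup G, χ g ≠ 0 :=
  CharacterModule.exists_character_apply_ne_zero_of_ne_zero hg

/-- Summing χ(g), as a phase, over all pairs in both orders leaves only χ = 0 in one order and only
g = 0 in the other. The equality makes the plaquette operator, normalized by |G|, a true average
over Ĝ. -/
theorem card_dualGroup [Finite G] : Nat.card (DualGroup G) = Nat.card G := by
  classical
  have : Fintype G := Fintype.ofFinite G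
  have : Fintype (DualGroup G) := Fintype.ofFinite _
  have h := Finset.sum_comm (s := Finset.univ) (t := Finset.univ)
    (f := fun (χ : DualGroup G) (g : G) => phase (χ g))
  have hl : ∑ χ : DualGroup G, ∑ g : G, phase (χ g) = Fintype.card G := by
    rw [Finset.sum_eq_single 0 (fun χ _ hχ => sum_phase_eq_zero hχ) (by simp)]
    simp [phase_zero]
  have hr : ∑ g : G, ∑ χ : DualGroup G, phase (χ g) = Fintype.card (DualGroup G) := by
    rw [Finset.sum_eq_single 0 (fun g _ hg => ?_) (by simp)]
    · simp [phase_zero]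
    · obtain ⟨χ, hχ⟩ := exists_dualGroup_apply_ne_zero hg
      exact sum_phase_eq_zero (f := AddMonoidHom.eval g) (DFunLike.ne_iff.2 ⟨χ, hχ⟩)
  rw [hl, hr] at h
  rw [Nat.card_eq_fintype_card, Nat.card_eq_fintype_card]
  exact_mod_cast h.symm

/-- Orthogonality of the characters of the finite group `G^I`. -/
theorem sum_phase_pi_eq_zero [Finite G] {I : Type*} [Fintype I] [Fintype (I → DualGroup G)]
    {k : I → G} (hk : k ≠ 0) :
    ∑ b : I → DualGroup G, phase (∑ i, b i (k i)) = 0 := by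
  classical
  obtain ⟨i, hi⟩ := Function.ne_iff.1 hk
  obtain ⟨χ, hχ⟩ := exists_dualGroup_apply_ne_zero hi
  let f : (I → DualGroup G) →+ AddCircle (1 : ℚ) :=
    { toFun := fun b => ∑ i, b i (k i)
      map_zero' := by simp
      map_add' := fun b b' => by simp [Finset.sum_add_distrib] }
  have hf : f (Pi.single i χ) = χ (k i) := by
    change ∑ j, (Pi.single i χ : I → DualGroup G) j (k j) = χ (k i)
    rw [Finset.sum_eq_single i]
    · rw [Pi.single_eq_same]
    · intro j _ hj
      rw [Pi.single_eq_of_ne hj]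
      rfl
    · simp
  exact sum_phase_eq_zero (f := f) (DFunLike.ne_iff.2 ⟨Pi.single i χ, hf ▸ hχ⟩)

variable (S G) in
/-- The linear span of the Weyl operators `Z^b X^a`. -/
def weylSpan : Submodule ℂ (QuasiLocal S G) :=
  Submodule.span ℂ {A | ∃ (b : S →₀ DualGroup G) (a : S →₀ G), A = pauliZ b * pauliX a}

theorem IsWeyl.mem_weylSpan {A : QuasiLocal S G} {b : S →₀ DualGroup G} {a : S →₀ G}
    (h : IsWeyl A b a) : A ∈ weylSpan S G := by
  obtain ⟨c, rfl⟩ := h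
  exact Submodule.smul_mem _ _ (Submodule.subset_span ⟨b, a, rfl⟩)

theorem isWeyl_mul (b : S →₀ DualGroup G) (a : S →₀ G) :
    IsWeyl (pauliZ b * pauliX a) b a := ⟨1, (one_smul _ _).symm⟩

theorem mul_mem_weylSpan {A B : QuasiLocal S G} (hA : A ∈ weylSpan S G) (hB : B ∈ weylSpan S G) :
    A * B ∈ weylSpan S G := by
  have h := Submodule.mul_mem_mul hA hB
  rw [weylSpan, Submodule.span_mul_span] at h
  refine Submodule.span_le.2 ?_ h
  rintro _ ⟨_, ⟨b, a, rfl⟩, _, ⟨b', a', rfl⟩, rfl⟩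
  exact ((isWeyl_mul b a).mul (isWeyl_mul b' a')).mem_weylSpan

theorem star_mem_weylSpan {A : QuasiLocal S G} (hA : A ∈ weylSpan S G) :
    star A ∈ weylSpan S G := by
  induction hA using Submodule.span_induction with
  | mem x hx =>
    obtain ⟨b, a, rfl⟩ := hx
    exact (isWeyl_mul b a).star.mem_weylSpan
  | zero => simp
  | add x y _ _ hx hy => rw [star_add]; exact add_mem hx hy
  | smul c x _ hx => rw [star_smul]; exact Submodule.smul_mem _ _ hx

/-- A coefficient of the image of a vector, as a linear functional. -/
def coeffFunctional (ψ : ConfigSpace S G) (h : S → G) : QuasiLocal S G →ₗ[ℂ] ℂ where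
  toFun A := (A : ConfigSpace S G →L[ℂ] ConfigSpace S G) ψ h
  map_add' _ _ := rfl
  map_smul' _ _ := rfl

/-- The extension by zero of a function on a finite set. -/
def extendZero {M : Type*} [AddCommGroup M] (Λ : Finset S) (k : Λ → M) : S →₀ M :=
  Finsupp.indicator Λ fun s hs => k ⟨s, hs⟩

theorem pairing_extendZero (Λ : Finset S) (b : Λ → DualGroup G) (h : S → G) :
    pairing (extendZero Λ b) h = ∑ s : Λ, b s (h s) := by
  classical
  have h1 : ∀ s : Λ, b s (h s) = extendZero Λ b s (h s) := fun s => by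
    rw [extendZero, Finsupp.indicator_of_mem s.2]
  rw [pairing, finsum_eq_sum_of_support_subset (s := Λ), ← Finset.sum_coe_sort]
  · exact Finset.sum_congr rfl fun s _ => (h1 s).symm
  · intro s hs
    by_contra hn
    refine hs ?_
    have h0 : extendZero Λ b s = 0 := Finsupp.indicator_of_notMem hn _
    simp [h0]

theorem sub_extendZero_eq_glue (Λ : Finset S) (h : S → G) (k : Λ → G) :
    h - extendZero Λ ((fun s : Λ => h s) - k) = glue Λ h k := by
  funext s
  by_cases hs : s ∈ Λ
  · simp [glue, hs, extendZero, Finsupp.indicator_of_mem hs]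
  · simp [glue, hs, extendZero, Finsupp.indicator_of_notMem hs]

/-- Fourier inversion on G^Λ: averaging e^{-2πi b(j)} Z^b over all b projects onto the
configurations that equal j on Λ. Followed on the right by X^{j-k}, this gives the matrix unit
|j⟩⟨k|, and the operator is the combination of matrix units with coefficients `M j k`. -/
theorem IsLocalOn.exists_mem_weylSpan [Finite G] {Λ : Finset S}
    {T : ConfigSpace S G →L[ℂ] ConfigSpace S G} (hT : IsLocalOn Λ T) :
    ∃ A ∈ weylSpan S G, (A : ConfigSpace S G →L[ℂ] ConfigSpace S G) = T := by
  classical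
  have : Fintype G := Fintype.ofFinite G
  have : Fintype (DualGroup G) := Fintype.ofFinite _
  obtain ⟨M, hM⟩ := hT
  let N : ℂ := (Fintype.card (Λ → DualGroup G) : ℂ)
  have hN : N ≠ 0 := Nat.cast_ne_zero.2 Fintype.card_ne_zero
  refine ⟨∑ j : Λ → G, ∑ k : Λ → G, M j k • N⁻¹ • ∑ b : Λ → DualGroup G,
    phase (-∑ s, b s (j s)) • (pauliZ (extendZero Λ b) * pauliX (extendZero Λ (j - k))), ?_, ?_⟩
  · refine sum_mem fun j _ => sum_mem fun k _ => Submodule.smul_mem _ _ <|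
      Submodule.smul_mem _ _ <| sum_mem fun b _ => Submodule.smul_mem _ _ <|
      (isWeyl_mul _ _).mem_weylSpan
  · ext ψ h
    rw [hM, finsum_eq_sum_of_fintype]
    have hb : ∀ j k : Λ → G, coeffFunctional ψ h (M j k • N⁻¹ • ∑ b : Λ → DualGroup G,
        phase (-∑ s, b s (j s)) • (pauliZ (extendZero Λ b) * pauliX (extendZero Λ (j - k)))) =
        M j k * N⁻¹ * (∑ b : Λ → DualGroup G, phase (∑ s, b s (((fun s : Λ => h s) - j) s))) *
          ψ (h - extendZero Λ (j - k)) := by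
      intro j k
      rw [map_smul, map_smul, map_sum, smul_eq_mul, smul_eq_mul, mul_assoc, mul_assoc,
        Finset.sum_mul]
      congr 2
      refine Finset.sum_congr rfl fun b _ => ?_
      rw [map_smul, smul_eq_mul]
      change _ * ((pauliZ _ * pauliX _ : QuasiLocal S G) :
        ConfigSpace S G →L[ℂ] ConfigSpace S G) ψ h = _
      rw [coe_mul_apply, coe_pauliZ_apply, coe_pauliX_apply, ← mul_assoc, ← phase_add,
        pairing_extendZero]
      congr 2
      rw [neg_add_eq_sub, ← Finset.sum_sub_distrib]
      simp
    change coeffFunctional ψ h _ = _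
    -- By orthogonality only the row j = h|_Λ survives, and there the sum over b equals the
    -- normalization `N`.
    rw [map_sum, Finset.sum_eq_single (fun s : Λ => h s)]
    · rw [map_sum]
      refine Finset.sum_congr rfl fun k _ => ?_
      rw [hb, sub_extendZero_eq_glue]
      congr 1
      simp [phase_zero, N]
    · intro j _ hj
      rw [map_sum]
      refine Finset.sum_eq_zero fun k _ => ?_
      rw [hb, sum_phase_pi_eq_zero (sub_ne_zero.2 hj.symm), mul_zero, zero_mul]
    · simp

/-- The span of the Weyl operators is dense in the quasi-local algebra. -/
theorem dense_weylSpan [Finite G] : Dense (weylSpan S G : Set (QuasiLocal S G)) := by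
  intro A
  rw [closure_subtype]
  -- The quasi-local algebra is a closure by definition, so it is enough that the Weyl span contains
  -- the star algebra generated by local operators. It does, being itself closed under products and
  -- adjoints.
  refine closure_mono ?_ A.2
  intro T hT
  change T ∈ StarAlgebra.adjoin ℂ _ at hT
  induction hT using StarAlgebra.adjoin_induction with
  | mem T hT =>
    obtain ⟨Λ, hT⟩ := hT
    exact hT.exists_mem_weylSpan
  | algebraMap r =>
    refine ⟨r • 1, Submodule.smul_mem _ _ ?_, (Algebra.algebraMap_eq_smul_one r).symm⟩
    exact pauliX_zero (S := S) (G := G) ▸ (isWeyl_pauliX 0).mem_weylSpan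
  | add x y _ _ hx hy =>
    obtain ⟨A, hA, rfl⟩ := hx
    obtain ⟨B, hB, rfl⟩ := hy
    exact ⟨A + B, add_mem hA hB, rfl⟩
  | mul x y _ _ hx hy =>
    obtain ⟨A, hA, rfl⟩ := hx
    obtain ⟨B, hB, rfl⟩ := hy
    exact ⟨A * B, mul_mem_weylSpan hA hB, rfl⟩
  | star x _ hx =>
    obtain ⟨A, hA, rfl⟩ := hx
    exact ⟨star A, star_mem_weylSpan hA, rfl⟩

end Density

open Filter Topology

/-! ### Strong convergence of bounded nets of operators. -/

section StrongConvergence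

variable {I H : Type*} [Preorder I] [NormedAddCommGroup H] [InnerProductSpace ℂ H]

theorem StrongTendsto.const (L : H →L[ℂ] H) : StrongTendsto (fun _ : I => L) L :=
  fun _ => tendsto_const_nhds

theorem StrongTendsto.const_mul {F : I → H →L[ℂ] H} {L : H →L[ℂ] H} (h : StrongTendsto F L)
    (B : H →L[ℂ] H) : StrongTendsto (fun i => B * F i) (B * L) :=
  fun v => (B.continuous.tendsto _).comp (h v)

theorem StrongTendsto.const_smul {F : I → H →L[ℂ] H} {L : H →L[ℂ] H} (h : StrongTendsto F L)
    (c : ℂ) : StrongTendsto (fun i => c • F i) (c • L) :=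
  fun v => (h v).const_smul c

theorem StrongTendsto.congr {F F' : I → H →L[ℂ] H} {L : H →L[ℂ] H} (h : StrongTendsto F L)
    (hF : F =ᶠ[atTop] F') : StrongTendsto F' L :=
  fun v => (h v).congr' <| hF.mono fun i hi => by rw [hi]

/-- Multiplication is jointly strongly continuous if the first factor is bounded. -/
theorem StrongTendsto.mul {F F' : I → H →L[ℂ] H} {L L' : H →L[ℂ] H} (h : StrongTendsto F L)
    (h' : StrongTendsto F' L') (hb : ∀ i, ‖F i‖ ≤ 1) :
    StrongTendsto (fun i => F i * F' i) (L * L') := by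
  intro v
  -- The difference from F_i L'v tends to zero by the uniform bound on F_i; the remaining F_i L'v
  -- converges by hypothesis.
  have h1 : Tendsto (fun i => F i (F' i v - L' v)) atTop (𝓝 0) := by
    have h0 : Tendsto (fun i => ‖F' i v - L' v‖) atTop (𝓝 0) :=
      tendsto_iff_norm_sub_tendsto_zero.1 (h' v)
    exact squeeze_zero_norm (fun i => (F i).le_of_opNorm_le_of_le (hb i) le_rfl |>.trans
      (one_mul _).le) h0
  have h2 := h1.add (h (L' v))
  rw [zero_add] at h2
  refine h2.congr fun i => ?_
  rw [map_sub, sub_add_cancel]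
  rfl

variable [(atTop : Filter I).NeBot]

theorem StrongTendsto.unique {F : I → H →L[ℂ] H} {L L' : H →L[ℂ] H} (h : StrongTendsto F L)
    (h' : StrongTendsto F L') : L = L' := by
  ext v
  exact tendsto_nhds_unique (h v) (h' v)

variable [CompleteSpace H]

/-- Taking adjoints is not strongly continuous, so convergence of the adjoints has to be assumed;
the limit is then identified by passing to the limit in inner products. -/
theorem StrongTendsto.star_eq {F : I → H →L[ℂ] H} {L L' : H →L[ℂ] H} (h : StrongTendsto F L)
    (h' : StrongTendsto (fun i => star (F i)) L') : L' = star L := by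
  refine (ContinuousLinearMap.eq_adjoint_iff _ _).2 fun x y => ?_
  refine tendsto_nhds_unique ((h' x).inner tendsto_const_nhds)
    ((tendsto_const_nhds.inner (h y)).congr fun i => ?_)
  exact (ContinuousLinearMap.adjoint_inner_left (F i) y x).symm

/-- The vectors on which a net of operators converges form a subspace. -/
def convergenceSpace (F : I → H →L[ℂ] H) : Submodule ℂ H where
  carrier := {v | ∃ w, Tendsto (fun i => F i v) atTop (𝓝 w)}
  add_mem' := by
    rintro v v' ⟨w, hw⟩ ⟨w', hw'⟩
    exact ⟨w + w', by simpa using hw.add hw'⟩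
  zero_mem' := ⟨0, by simp⟩
  smul_mem' := by
    rintro c v ⟨w, hw⟩
    exact ⟨c • w, by simpa using hw.const_smul c⟩

/-- A uniformly bounded net that converges on vectors arbitrarily close to v is Cauchy at v, and `H`
is complete. -/
theorem isClosed_convergenceSpace {F : I → H →L[ℂ] H} (hb : ∀ i, ‖F i‖ ≤ 1) :
    IsClosed (convergenceSpace F : Set H) := by
  refine isClosed_of_closure_subset fun v hv => ?_
  refine cauchy_map_iff_exists_tendsto.1 (Metric.cauchy_iff.2 ⟨inferInstance, fun ε hε => ?_⟩)
  -- One ε/4 for v against v' (the operators are contractions) and one for F_i v' against w: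
  -- eventually F_i v lies in the ball of radius ε/2 around w, whose points are less than ε apart.
  obtain ⟨v', ⟨w, hw⟩, hvv'⟩ := Metric.mem_closure_iff.1 hv (ε / 4) (by positivity)
  refine ⟨Metric.ball w (ε / 2), ?_, fun x hx y hy => ?_⟩
  · rw [mem_map]
    filter_upwards [Metric.tendsto_nhds.1 hw (ε / 4) (by positivity)] with i hi
    have h1 : dist (F i v) (F i v') ≤ dist v v' := by
      rw [dist_eq_norm, dist_eq_norm, ← map_sub]
      exact ((F i).le_of_opNorm_le_of_le (hb i) le_rfl).trans (one_mul _).le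
    have h2 := dist_triangle (F i v) (F i v') w
    rw [Set.mem_preimage, Metric.mem_ball]
    linarith
  · have h2 := dist_triangle_right x y w
    rw [Metric.mem_ball] at hx hy
    linarith

omit [CompleteSpace H] in
theorem exists_strongTendsto {F : I → H →L[ℂ] H} (hb : ∀ i, ‖F i‖ ≤ 1)
    (h : ∀ v, v ∈ convergenceSpace F) : ∃ L, StrongTendsto F L := by
  choose f hf using h
  let L : H →ₗ[ℂ] H := linearMapOfTendsto (l := atTop) f (fun i => (F i : H →ₗ[ℂ] H))
    (tendsto_pi_nhds.2 hf)
  refine ⟨L.mkContinuous 1 fun v => ?_, hf⟩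
  exact le_of_tendsto (hf v).norm (Eventually.of_forall fun i =>
    (F i).le_of_opNorm_le_of_le (hb i) le_rfl)

end StrongConvergence

/-! ### Representations of the quasi-local algebra and the GNS vector. -/

section Representation

variable {S G H : Type*} [NormedAddCommGroup H] [InnerProductSpace ℂ H]
  [CompleteSpace H] {ω : QuasiLocal S G →ₗ[ℂ] ℂ} {π : QuasiLocal S G →⋆ₐ[ℂ] (H →L[ℂ] H)} {Ω : H}

/-- The quasi-local algebra is norm closed, hence a C*-algebra, and star homomorphisms of
C*-algebras are contractive. -/
theorem continuous_representation (π : QuasiLocal S G →⋆ₐ[ℂ] (H →L[ℂ] H)) : Continuous π := by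
  let _ : CStarAlgebra (ConfigSpace S G →L[ℂ] ConfigSpace S G) := {}
  let _ : CStarAlgebra (H →L[ℂ] H) := {}
  have : IsClosed (quasiLocal S G : Set (ConfigSpace S G →L[ℂ] ConfigSpace S G)) :=
    StarSubalgebra.isClosed_topologicalClosure _
  exact AddMonoidHomClass.continuous_of_bound π 1 fun A => by
    rw [one_mul]
    exact NonUnitalStarAlgHom.norm_apply_le π A

theorem norm_representation_le_one (π : QuasiLocal S G →⋆ₐ[ℂ] (H →L[ℂ] H)) {A : QuasiLocal S G}
    (hA : star A * A = 1) : ‖π A‖ ≤ 1 := by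
  have h := CStarRing.norm_star_mul_self (x := π A)
  rw [← map_star, ← map_mul, hA, map_one] at h
  have h1 : ‖(1 : H →L[ℂ] H)‖ ≤ 1 := ContinuousLinearMap.norm_id_le
  nlinarith [norm_nonneg (π A)]

theorem IsGNS.norm_eq_one (hπ : IsGNS ω π Ω) (hω : IsState ω) : ‖Ω‖ = 1 := by
  have h := hπ.vector_state 1
  rw [hω.2, map_one] at h
  have h1 : inner ℂ Ω Ω = (1 : ℂ) := h.symm
  have h2 := inner_self_eq_norm_sq (𝕜 := ℂ) Ω
  rw [h1, RCLike.one_re] at h2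
  nlinarith [norm_nonneg Ω]

/-- The equality case of Cauchy–Schwarz: ‖Ω - π(A)Ω‖² = 1 - 2 + ‖π(A)Ω‖² ≤ 0. -/
theorem representation_apply_eq_of_re_inner {A : QuasiLocal S G} (hA : star A * A = 1)
    (hΩ : ‖Ω‖ = 1) (h : (inner ℂ Ω (π A Ω)).re = 1) : π A Ω = Ω := by
  have h1 : ‖π A Ω‖ ≤ 1 := by
    have := (π A).le_of_opNorm_le_of_le (norm_representation_le_one π hA) hΩ.le
    simpa using this
  have h2 := norm_sub_sq (𝕜 := ℂ) Ω (π A Ω)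
  rw [hΩ] at h2
  change _ = _ - 2 * (inner ℂ Ω (π A Ω)).re + _ at h2
  rw [h] at h2
  have h3 : ‖Ω - π A Ω‖ = 0 := by
    have := norm_nonneg (π A Ω)
    nlinarith [norm_nonneg (Ω - π A Ω)]
  exact (sub_eq_zero.1 (norm_eq_zero.1 h3)).symm

/-- If the average of finitely many unitaries has expectation `1`, each of them fixes the GNS
vector. -/
theorem IsGNS.apply_eq_of_average (hπ : IsGNS ω π Ω) (hω : IsState ω) {J : Type*}
    [Finite J] [Nonempty J] {N : ℂ} (hN : N = Nat.card J) {A : J → QuasiLocal S G}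
    (hA : ∀ j, star (A j) * A j = 1) (h : ω (N⁻¹ • ∑ᶠ j, A j) = 1) (j : J) : π (A j) Ω = Ω := by
  have := Fintype.ofFinite J
  have hΩ := hπ.norm_eq_one hω
  refine representation_apply_eq_of_re_inner (hA j) hΩ ?_
  have hle : ∀ j ∈ (Finset.univ : Finset J), (inner ℂ Ω (π (A j) Ω)).re ≤ 1 := fun j _ => by
    refine (Complex.re_le_norm _).trans ((norm_inner_le_norm _ _).trans ?_)
    have := (π (A j)).le_of_opNorm_le_of_le (norm_representation_le_one π (hA j)) hΩ.le
    rw [hΩ]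
    simpa using this
  -- Each real part is at most 1 and they add up to the number of terms, so all of them equal 1.
  refine (Finset.sum_eq_sum_iff_of_le hle).1 ?_ j (Finset.mem_univ j)
  rw [finsum_eq_sum_of_fintype, map_smul, map_sum, smul_eq_mul] at h
  have hN0 : N ≠ 0 := hN ▸ Nat.cast_ne_zero.2 Nat.card_pos.ne'
  have h1 := (inv_mul_eq_iff_eq_mul₀ hN0).1 h
  rw [mul_one, hN] at h1
  have h2 := congrArg Complex.re h1
  rw [Complex.re_sum, Complex.natCast_re] at h2
  simp only [← hπ.vector_state]
  rw [h2]
  simp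

variable [AddCommGroup G]

/-- The vectors `Z^b X^a Ω` span a dense subspace. -/
theorem IsGNS.mem_of_weyl [Finite G] (hπ : IsGNS ω π Ω) {N : Submodule ℂ H}
    (hN : IsClosed (N : Set H))
    (h : ∀ (b : S →₀ DualGroup G) (a : S →₀ G), π (pauliZ b * pauliX a) Ω ∈ N) (v : H) :
    v ∈ N := by
  have hc : Continuous fun A => π A Ω := by
    have := continuous_representation π
    fun_prop
  -- Density enters twice: the Weyl span is dense in the algebra and A ↦ π(A)Ω is continuous, which
  -- gives all π(A)Ω; cyclicity then gives all of `H`.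
  have h1 : ∀ A, π A Ω ∈ N := fun A => by
    have hcl : IsClosed {A | π A Ω ∈ N} := hN.preimage hc
    refine hcl.closure_subset_iff.2 (fun A hA => ?_) (dense_weylSpan A)
    change A ∈ weylSpan S G at hA
    change π A Ω ∈ N
    induction hA using Submodule.span_induction with
    | mem x hx =>
      obtain ⟨b, a, rfl⟩ := hx
      exact h b a
    | zero => simp
    | add x y _ _ hx hy => rw [map_add]; exact add_mem hx hy
    | smul c x _ hx => rw [map_smul]; exact N.smul_mem c hx
  refine hN.closure_subset_iff.2 ?_ (hπ.cyclic v)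
  rintro _ ⟨A, rfl⟩
  exact h1 A

theorem star_pauliX_mul_self (a : S →₀ G) : star (pauliX a) * pauliX a = 1 := by
  rw [star_pauliX, ← pauliX_add, neg_add_cancel, pauliX_zero]

theorem star_pauliZ_mul_self (b : S →₀ DualGroup G) : star (pauliZ b) * pauliZ b = 1 := by
  rw [star_pauliZ, ← pauliZ_add, ← pauliZ_zero]
  congr 1
  exact neg_add_cancel b

end Representation

/-! ### Stabilizers fix the ground state vector. -/

section GroundState

variable {Su S Sl G H : Type*} [AddCommGroup G] [Finite G] [NormedAddCommGroup H]
  [InnerProductSpace ℂ H] [CompleteSpace H] {Du : IncidenceMatrix Su S} {Dl : IncidenceMatrix S Sl}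
  {ω : QuasiLocal S G →ₗ[ℂ] ℂ} {π : QuasiLocal S G →⋆ₐ[ℂ] (H →L[ℂ] H)} {Ω : H}

/-- The GNS vector of a frustration free ground state is fixed by `X^{∂ᵀc}`. -/
theorem IsFrustrationFree.pauliX_coboundary_apply (hω : IsFrustrationFree Du Dl ω)
    (hπ : IsGNS ω π Ω) (c : Sl →₀ G) : π (pauliX (Dl.coboundaryFin c)) Ω = Ω := by
  induction c using Finsupp.induction_linear with
  | zero => rw [Dl.coboundaryFin_zero, pauliX_zero, map_one]; rfl
  | add c c' hc hc' =>
    rw [Dl.coboundaryFin_add, pauliX_add, map_mul, mul_apply_eq_comp, hc', hc]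
  | single α g =>
    exact hπ.apply_eq_of_average hω.isState rfl (fun _ => star_pauliX_mul_self _)
      (hω.apply_starOp α) g

/-- The GNS vector of a frustration free ground state is fixed by `Z^{∂c}`. -/
theorem IsFrustrationFree.pauliZ_boundary_apply (hω : IsFrustrationFree Du Dl ω)
    (hπ : IsGNS ω π Ω) (c : Su →₀ DualGroup G) : π (pauliZ (Du.boundaryFin c)) Ω = Ω := by
  induction c using Finsupp.induction_linear with
  | zero => rw [Du.boundaryFin_zero, pauliZ_zero, map_one]; rfl
  | add c c' hc hc' =>
    rw [Du.boundaryFin_add, pauliZ_add, map_mul, mul_apply_eq_comp, hc', hc]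
  | single α g =>
    -- The normalization |G| has to be read as |Ĝ|, the number of unitaries averaged.
    exact hπ.apply_eq_of_average hω.isState (congrArg Nat.cast card_dualGroup.symm)
      (fun _ => star_pauliZ_mul_self _) (hω.apply_plaquetteOp α) g

end GroundState

/-! ### Phases of the transporter nets under commutation and under ρ. -/

namespace TransportData

variable {Su S Sl G : Type*} [AddCommGroup G]
  {Du : IncidenceMatrix Su S} {Dl : IncidenceMatrix S Sl}

/-- The factor `X^{∂ᵀ(q_{K₋})} Z^{∂(p_{K₊})}` of `U_{K₊,K₋}`, which fixes the ground state. -/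
def stabilizerNet (T : TransportData Du Dl G) (K : Finset Su × Finset Sl) : QuasiLocal S G :=
  pauliX (Dl.coboundaryFin (restrict T.q K.2)) * pauliZ (Du.boundaryFin (restrict T.p K.1))

/-- The factor `Z^{-γ̂} X^{-δ̂}` of `U_{K₊,K₋}`. -/
def stringOp (T : TransportData Du Dl G) : QuasiLocal S G :=
  pauliZ (-T.γhat) * pauliX (-T.δhat)

theorem net_eq (T : TransportData Du Dl G) (K : Finset Su × Finset Sl) :
    T.net K = T.stringOp * T.stabilizerNet K := by
  rw [net, stringOp, stabilizerNet, mul_assoc (_ * _)]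

theorem isWeyl_stabilizerNet (T : TransportData Du Dl G) (K : Finset Su × Finset Sl) :
    IsWeyl (T.stabilizerNet K) (Du.boundaryFin (restrict T.p K.1))
      (Dl.coboundaryFin (restrict T.q K.2)) := by
  have h := (isWeyl_pauliX (Dl.coboundaryFin (restrict T.q K.2))).mul
    (isWeyl_pauliZ (Du.boundaryFin (restrict T.p K.1)))
  rwa [AddZeroClass.zero_add (Du.boundaryFin _), add_zero] at h

theorem isWeyl_stringOp (T : TransportData Du Dl G) :
    IsWeyl T.stringOp (-T.γhat) (-T.δhat) := isWeyl_mul _ _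

theorem star_stabilizerNet_mul_self (T : TransportData Du Dl G) (K : Finset Su × Finset Sl) :
    star (T.stabilizerNet K) * T.stabilizerNet K = 1 := by
  rw [stabilizerNet, star_mul, mul_assoc, ← mul_assoc (star (pauliX _)), star_pauliX_mul_self,
    one_mul, star_pauliZ_mul_self]

theorem stabilizerNet_mul_star_self (T : TransportData Du Dl G) (K : Finset Su × Finset Sl) :
    T.stabilizerNet K * star (T.stabilizerNet K) = 1 := by
  rw [stabilizerNet, star_mul, mul_assoc, ← mul_assoc (pauliZ _), star_pauliX, star_pauliZ,
    pauliZ_mul_neg, one_mul, pauliX_mul_neg]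

theorem star_stringOp_mul_self (T : TransportData Du Dl G) :
    star T.stringOp * T.stringOp = 1 := by
  rw [stringOp, star_mul, mul_assoc, ← mul_assoc (star (pauliZ _)), star_pauliZ_mul_self,
    one_mul, star_pauliX_mul_self]

/-- The exponent `⟨p, ∂ᵀa⟩ - ⟨∂b, q⟩` of the phase by which the limit of `X^{∂ᵀ(q_{K₋})} Z^{∂(p_{K₊})}`
commutes with `Z^b X^a`. -/
def monodromy (T : TransportData Du Dl G) (b : S →₀ DualGroup G) (a : S →₀ G) :
    AddCircle (1 : ℚ) :=
  pairing T.p (Du.coboundary a) - pairing (Dl.boundary b) T.q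

theorem monodromy_neg (T : TransportData Du Dl G) (b : S →₀ DualGroup G) (a : S →₀ G) :
    T.monodromy (-b) (-a) = -T.monodromy b a := by
  unfold monodromy
  rw [Finsupp.coe_neg, Finsupp.coe_neg, Du.coboundary_neg, Dl.boundary_neg, pairing_neg_left,
    pairing_neg_right]
  abel

instance : (atTop : Filter (Finset Su × Finset Sl)).NeBot := by
  rw [← prod_atTop_atTop_eq]
  infer_instance

theorem tendsto_fst_atTop_finset :
    Tendsto (Prod.fst : Finset Su × Finset Sl → Finset Su) atTop atTop := by
  rw [← prod_atTop_atTop_eq]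
  exact tendsto_fst

theorem tendsto_snd_atTop_finset :
    Tendsto (Prod.snd : Finset Su × Finset Sl → Finset Sl) atTop atTop := by
  rw [← prod_atTop_atTop_eq]
  exact tendsto_snd

/-- The pairing of the boundary of `p_{K₊}` with a cochain of finitely supported coboundary is
eventually constant. -/
theorem eventually_pairing_boundary (T : TransportData Du Dl G) {a : S → G}
    (ha : (Function.support (Du.coboundary a)).Finite) :
    ∀ᶠ K : Finset Su × Finset Sl in atTop,
      pairing (Du.boundaryFin (restrict T.p K.1)) a = pairing T.p (Du.coboundary a) := by
  filter_upwards [tendsto_fst_atTop_finset.eventually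
    (eventually_pairing_restrict_left T.p ha)] with K hK
  rw [Du.coe_boundaryFin, Du.pairing_boundary, hK]

theorem eventually_pairing_coboundary (T : TransportData Du Dl G) {b : S → DualGroup G}
    (hb : (Function.support (Dl.boundary b)).Finite) :
    ∀ᶠ K : Finset Su × Finset Sl in atTop,
      pairing b (Dl.coboundaryFin (restrict T.q K.2)) = pairing (Dl.boundary b) T.q := by
  filter_upwards [tendsto_snd_atTop_finset.eventually
    (eventually_pairing_restrict_right T.q hb)] with K hK
  rw [Dl.coe_coboundaryFin, Dl.pairing_coboundary, hK]

/-- By adjointness, the commutation exponent ⟨∂p_{K₊}, a⟩ - ⟨b, ∂ᵀq_{K₋}⟩ only sees p on the support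
of ∂ᵀa and q on that of ∂b. Both supports are finite. -/
theorem eventually_stabilizerNet_mul (T : TransportData Du Dl G) {A : QuasiLocal S G}
    {b : S →₀ DualGroup G} {a : S →₀ G} (h : IsWeyl A b a) :
    ∀ᶠ K in atTop, T.stabilizerNet K * A = phase (T.monodromy b a) • (A * T.stabilizerNet K) := by
  filter_upwards [T.eventually_pairing_boundary (Du.coboundaryFin a).hasFiniteSupport,
    T.eventually_pairing_coboundary (Dl.boundaryFin b).hasFiniteSupport] with K hK hK'
  rw [(T.isWeyl_stabilizerNet K).mul_comm_phase h, hK, hK']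
  rfl

theorem eventually_star_stabilizerNet_mul (T : TransportData Du Dl G) {A : QuasiLocal S G}
    {b : S →₀ DualGroup G} {a : S →₀ G} (h : IsWeyl A b a) :
    ∀ᶠ K in atTop, star (T.stabilizerNet K) * A =
      phase (-T.monodromy b a) • (A * star (T.stabilizerNet K)) := by
  -- The adjoint of A is a Weyl operator with labels (-b, -a); taking adjoints in its commutation
  -- relation reverses the products.
  filter_upwards [T.eventually_stabilizerNet_mul h.star] with K hK
  have h1 := congrArg star hK
  rw [star_mul, star_smul, star_mul, star_star, monodromy_neg, phase_neg, star_star] at h1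
  rw [h1, smul_smul, mul_comm, phase_mul_neg, one_smul]

/-- The exponent of the phase by which `ρ_{(γ',δ')}` multiplies the adjoint of `U_{K₊,K₋}`, for large
`K₊` and `K₋`. -/
def rhoExponent (T T' : TransportData Du Dl G) : AddCircle (1 : ℚ) :=
  pairing T'.γ T.δhat - pairing (Dl.boundary T'.γ) T.q - pairing T.γhat T'.δ
    + pairing T.p (Du.coboundary T'.δ)

theorem isWeyl_net (T : TransportData Du Dl G) (K : Finset Su × Finset Sl) :
    IsWeyl (T.net K) (-T.γhat + Du.boundaryFin (restrict T.p K.1))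
      (-T.δhat + Dl.coboundaryFin (restrict T.q K.2)) := by
  rw [net_eq]
  exact T.isWeyl_stringOp.mul (T.isWeyl_stabilizerNet K)

/-- Here the localization of the endomorphism is used: γ and δ may have infinite support, but after
moving ∂ and ∂ᵀ across the pairing only ∂γ and ∂ᵀδ meet q and p. -/
theorem eventually_pairing_net (T T' : TransportData Du Dl G) :
    ∀ᶠ K : Finset Su × Finset Sl in atTop,
      pairing T'.γ (-T.δhat + Dl.coboundaryFin (restrict T.q K.2) : S →₀ G) -
        pairing (-T.γhat + Du.boundaryFin (restrict T.p K.1) : S →₀ DualGroup G) T'.δ =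
          -T.rhoExponent T' := by
  filter_upwards [T.eventually_pairing_boundary T'.finite_coboundary,
    T.eventually_pairing_coboundary T'.finite_boundary] with K hK hK'
  rw [pairing_add_right, pairing_add_left, hK, hK', Finsupp.coe_neg, Finsupp.coe_neg,
    pairing_neg_left, pairing_neg_right, rhoExponent]
  abel

theorem eventually_rho_net (T T' : TransportData Du Dl G) :
    ∀ᶠ K in atTop, rho T'.γ T'.δ (T.net K) = phase (-T.rhoExponent T') • T.net K := by
  filter_upwards [T.eventually_pairing_net T'] with K hK
  rw [(T.isWeyl_net K).rho_eq, hK]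

theorem eventually_rho_star_net (T T' : TransportData Du Dl G) :
    ∀ᶠ K in atTop,
      rho T'.γ T'.δ (star (T.net K)) = phase (T.rhoExponent T') • star (T.net K) := by
  filter_upwards [T.eventually_pairing_net T'] with K hK
  rw [(T.isWeyl_net K).star.rho_eq, Finsupp.coe_neg, Finsupp.coe_neg, pairing_neg_left,
    pairing_neg_right, neg_sub_neg, ← neg_sub, hK, neg_neg]

/-- The exponent of the phase by which the limits of the nets `U_1` and `U_2` commute. -/
def commutatorExponent (T₁ T₂ : TransportData Du Dl G) : AddCircle (1 : ℚ) :=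
  pairing T₁.γhat T₂.δhat - pairing T₂.γhat T₁.δhat +
    (T₁.monodromy (-T₂.γhat) (-T₂.δhat) - T₂.monodromy (-T₁.γhat) (-T₁.δhat))

/-- The terms of θ₁₂ with no hat on γ₂ or no hat on δ₁ come from the action of ρ; those with both
hats, or with a hat inside ∂ or ∂ᵀ, come from the commutator of U₁ and U₂. -/
theorem braidingTerms_sub (T₁ T₂ : TransportData Du Dl G) :
    braidingTerms T₁ T₂ - braidingTerms T₂ T₁ =
      T₁.rhoExponent T₂ - T₂.rhoExponent T₁ + commutatorExponent T₁ T₂ := by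
  rw [commutatorExponent, monodromy_neg, monodromy_neg]
  unfold braidingTerms rhoExponent monodromy
  abel

theorem stringOp_mul_comm (T₁ T₂ : TransportData Du Dl G) :
    T₁.stringOp * T₂.stringOp =
      phase (pairing T₁.γhat T₂.δhat - pairing T₂.γhat T₁.δhat) •
        (T₂.stringOp * T₁.stringOp) := by
  rw [T₁.isWeyl_stringOp.mul_comm_phase T₂.isWeyl_stringOp]
  simp only [Finsupp.coe_neg, pairing_neg_left, pairing_neg_right, neg_neg]

/-! ### Strong limits of the nets and the braiding phase. -/

section GroundState

variable [Finite G] {H : Type*} [NormedAddCommGroup H] [InnerProductSpace ℂ H] [CompleteSpace H]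
  {ω : QuasiLocal S G →ₗ[ℂ] ℂ} {π : QuasiLocal S G →⋆ₐ[ℂ] (H →L[ℂ] H)} {Ω : H}

/-- A net of unitaries that fix the GNS vector converges strongly if each Weyl operator eventually
commutes with it up to a constant. -/
theorem exists_strongTendsto_of_weyl {I : Type*} [Preorder I] [(atTop : Filter I).NeBot]
    (hπ : IsGNS ω π Ω) {F : I → QuasiLocal S G} (hF : ∀ i, star (F i) * F i = 1)
    (hΩ : ∀ i, π (F i) Ω = Ω)
    (h : ∀ (b : S →₀ DualGroup G) (a : S →₀ G), ∃ c : ℂ, ∀ᶠ i in atTop,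
      F i * (pauliZ b * pauliX a) = c • (pauliZ b * pauliX a * F i)) :
    ∃ V, StrongTendsto (fun i => π (F i)) V := by
  have hb : ∀ i, ‖π (F i)‖ ≤ 1 := fun i => norm_representation_le_one π (hF i)
  refine exists_strongTendsto hb (hπ.mem_of_weyl (isClosed_convergenceSpace hb) fun b a => ?_)
  obtain ⟨c, hc⟩ := h b a
  -- Commuting F_i to the right, where it fixes Ω, leaves only the constant c.
  refine ⟨c • π (pauliZ b * pauliX a) Ω, tendsto_nhds_of_eventually_eq ?_⟩
  filter_upwards [hc] with i hi
  rw [← mul_apply_eq_comp, ← map_mul, hi, map_smul, map_mul, smul_apply,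
    mul_apply_eq_comp, hΩ]

theorem stabilizerNet_apply (T : TransportData Du Dl G) (hω : IsFrustrationFree Du Dl ω)
    (hπ : IsGNS ω π Ω) (K : Finset Su × Finset Sl) : π (T.stabilizerNet K) Ω = Ω := by
  rw [stabilizerNet, map_mul, mul_apply_eq_comp, hω.pauliZ_boundary_apply hπ,
    hω.pauliX_coboundary_apply hπ]

/-- The nets `X^{∂ᵀ(q_{K₋})} Z^{∂(p_{K₊})}` and their adjoints converge strongly. -/
theorem exists_strongTendsto_stabilizerNet (T : TransportData Du Dl G)
    (hω : IsFrustrationFree Du Dl ω) (hπ : IsGNS ω π Ω) :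
    ∃ V : H →L[ℂ] H, StrongTendsto (fun K => π (T.stabilizerNet K)) V ∧
      StrongTendsto (fun K => π (star (T.stabilizerNet K))) (star V) := by
  have hΩ := T.stabilizerNet_apply hω hπ
  obtain ⟨V, hV⟩ := exists_strongTendsto_of_weyl hπ T.star_stabilizerNet_mul_self hΩ
    fun b a => ⟨_, T.eventually_stabilizerNet_mul (isWeyl_mul b a)⟩
  -- The adjoints need their own convergence argument; they also fix Ω, being inverses of unitaries
  -- that do.
  obtain ⟨V', hV'⟩ := exists_strongTendsto_of_weyl hπ (F := fun K => star (T.stabilizerNet K))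
    (fun K => by rw [star_star, stabilizerNet_mul_star_self])
    (fun K => by
      nth_rw 1 [← hΩ K]
      rw [← mul_apply_eq_comp, ← map_mul, star_stabilizerNet_mul_self, map_one]
      rfl)
    fun b a => ⟨_, T.eventually_star_stabilizerNet_mul (isWeyl_mul b a)⟩
  have h : V' = star V := hV.star_eq (by simpa only [map_star] using hV')
  exact ⟨V, hV, h ▸ hV'⟩

variable {T T₁ T₂ : TransportData Du Dl G} {V V₁ V₂ : H →L[ℂ] H}

omit [Finite G] in
/-- The commutation relations of the limit with Weyl operators. -/
theorem limit_mul_weyl (hV : StrongTendsto (fun K => π (T.stabilizerNet K)) V)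
    {A : QuasiLocal S G} {b : S →₀ DualGroup G} {a : S →₀ G} (h : IsWeyl A b a) :
    V * π A = phase (T.monodromy b a) • (π A * V) := by
  have h1 : StrongTendsto (fun K => π (T.stabilizerNet K) * π A) (V * π A) :=
    hV.mul (.const _) fun K => norm_representation_le_one π (T.star_stabilizerNet_mul_self K)
  refine h1.unique (((hV.const_mul (π A)).const_smul _).congr ?_)
  filter_upwards [T.eventually_stabilizerNet_mul h] with K hK
  rw [← map_mul, ← map_mul, hK, map_smul]

theorem limit_apply (hω : IsFrustrationFree Du Dl ω) (hπ : IsGNS ω π Ω)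
    (hV : StrongTendsto (fun K => π (T.stabilizerNet K)) V) : V Ω = Ω :=
  tendsto_nhds_unique (hV Ω)
    (tendsto_const_nhds.congr fun K => (T.stabilizerNet_apply hω hπ K).symm)

/-- Both limits are diagonal on the vectors Z^b X^a Ω, so the kernel of their commutator is a closed
subspace containing all of these. -/
theorem limit_mul_comm (hω : IsFrustrationFree Du Dl ω) (hπ : IsGNS ω π Ω)
    (hV₁ : StrongTendsto (fun K => π (T₁.stabilizerNet K)) V₁)
    (hV₂ : StrongTendsto (fun K => π (T₂.stabilizerNet K)) V₂) : V₁ * V₂ = V₂ * V₁ := by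
  have h : ∀ v, v ∈ (V₁ * V₂ - V₂ * V₁).ker :=
    hπ.mem_of_weyl (V₁ * V₂ - V₂ * V₁).isClosed_ker fun b a => by
      have e₁ : V₁ (π (pauliZ b * pauliX a) Ω) = phase (T₁.monodromy b a) •
          π (pauliZ b * pauliX a) Ω := by
        rw [← mul_apply_eq_comp, limit_mul_weyl hV₁ (isWeyl_mul b a),
          smul_apply, mul_apply_eq_comp, limit_apply hω hπ hV₁]
      have e₂ : V₂ (π (pauliZ b * pauliX a) Ω) = phase (T₂.monodromy b a) •
          π (pauliZ b * pauliX a) Ω := by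
        rw [← mul_apply_eq_comp, limit_mul_weyl hV₂ (isWeyl_mul b a),
          smul_apply, mul_apply_eq_comp, limit_apply hω hπ hV₂]
      rw [LinearMap.mem_ker]
      change V₁ (V₂ _) - V₂ (V₁ _) = 0
      rw [e₁, e₂, map_smul, map_smul, e₁, e₂, smul_comm, sub_self]
  ext v
  exact sub_eq_zero.1 (h v)

omit [Finite G] in
-- Strong limits of unitaries are isometries. The product of the adjoint net with the net is
-- constantly 1.
theorem star_limit_mul_self (hV : StrongTendsto (fun K => π (T.stabilizerNet K)) V)
    (hV' : StrongTendsto (fun K => π (star (T.stabilizerNet K))) (star V)) : star V * V = 1 := by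
  have h := hV'.mul hV fun K => norm_representation_le_one π
    (by rw [star_star, stabilizerNet_mul_star_self])
  refine h.unique ((StrongTendsto.const 1).congr (Eventually.of_forall fun K => ?_))
  change 1 = π _ * π _
  rw [← map_mul, star_stabilizerNet_mul_self, map_one]

omit [Finite G] in
theorem star_mul_limit_mul_self (hV : star V * V = 1) :
    star (π T.stringOp * V) * (π T.stringOp * V) = 1 := by
  rw [star_mul, mul_assoc, ← mul_assoc (star (π _)), ← map_star, ← map_mul,
    star_stringOp_mul_self, map_one, one_mul, hV]

/-- Three phases combine: V₁ passes the string operator of `T₂`, the two string operators are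
exchanged, and V₂ passes back over the string operator of `T₁`. V₁ and V₂ commute without a phase.
-/
theorem transporter_mul_comm (hω : IsFrustrationFree Du Dl ω) (hπ : IsGNS ω π Ω)
    (hV₁ : StrongTendsto (fun K => π (T₁.stabilizerNet K)) V₁)
    (hV₂ : StrongTendsto (fun K => π (T₂.stabilizerNet K)) V₂) :
    π T₁.stringOp * V₁ * (π T₂.stringOp * V₂) =
      phase (commutatorExponent T₁ T₂) • (π T₂.stringOp * V₂ * (π T₁.stringOp * V₁)) := by
  have key : ∀ {T T' : TransportData Du Dl G} {V V' : H →L[ℂ] H},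
      StrongTendsto (fun K => π (T.stabilizerNet K)) V →
      π T.stringOp * V * (π T'.stringOp * V') =
        phase (T.monodromy (-T'.γhat) (-T'.δhat)) • (π (T.stringOp * T'.stringOp) * (V * V')) := by
    intro T T' V V' hV
    rw [mul_assoc, ← mul_assoc V, limit_mul_weyl hV T'.isWeyl_stringOp, map_mul]
    simp only [smul_mul_assoc, mul_smul_comm, mul_assoc]
  rw [key hV₁, key hV₂, stringOp_mul_comm, limit_mul_comm hω hπ hV₁ hV₂, map_smul,
    smul_mul_assoc, smul_smul, smul_smul, ← phase_add, ← phase_add]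
  congr 2
  rw [commutatorExponent]
  abel

/-- Convergence of the braiding net, for arbitrary incidence matrices. -/
theorem exists_strongTendsto_braiding (T₁ T₂ : TransportData Du Dl G)
    (hω : IsFrustrationFree Du Dl ω) (hπ : IsGNS ω π Ω) :
    ∃ U₁ U₂ : H →L[ℂ] H,
      StrongTendsto (fun K => π (T₁.net K)) U₁ ∧
      StrongTendsto (fun K => π (T₂.net K)) U₂ ∧
      StrongTendsto
        (fun K => π (rho T₂.γ T₂.δ (star (T₁.net K))) * star U₂ * U₁ *
          π (rho T₁.γ T₁.δ (T₂.net K)))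
        (phase (braidingTerms T₁ T₂ - braidingTerms T₂ T₁) • π 1) := by
  obtain ⟨V₁, hV₁, hV₁'⟩ := T₁.exists_strongTendsto_stabilizerNet hω hπ
  obtain ⟨V₂, hV₂, hV₂'⟩ := T₂.exists_strongTendsto_stabilizerNet hω hπ
  have hU₁ : StrongTendsto (fun K => π (T₁.net K)) (π T₁.stringOp * V₁) := by
    simpa only [net_eq, map_mul] using hV₁.const_mul (π T₁.stringOp)
  have hU₂ : StrongTendsto (fun K => π (T₂.net K)) (π T₂.stringOp * V₂) := by
    simpa only [net_eq, map_mul] using hV₂.const_mul (π T₂.stringOp)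
  have hn : ∀ K, T₁.net K * star (T₁.net K) = 1 := fun K => by
    rw [net_eq, star_mul, mul_assoc, ← mul_assoc (T₁.stabilizerNet K),
      stabilizerNet_mul_star_self, one_mul, stringOp, star_mul, mul_assoc, ← mul_assoc (pauliX _),
      star_pauliX, star_pauliZ, pauliX_mul_neg, one_mul, pauliZ_mul_neg]
  have hU₁' : StrongTendsto (fun K => π (star (T₁.net K))) (star (π T₁.stringOp * V₁)) := by
    have h := hV₁'.mul (.const (π (star T₁.stringOp))) fun K => norm_representation_le_one π
      (by rw [star_star, stabilizerNet_mul_star_self])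
    simpa only [net_eq, star_mul, map_mul, map_star] using h
  have hc := transporter_mul_comm hω hπ hV₁ hV₂
  have hs₁ := star_mul_limit_mul_self (π := π) (T := T₁) (star_limit_mul_self hV₁ hV₁')
  have hs₂ := star_mul_limit_mul_self (π := π) (T := T₂) (star_limit_mul_self hV₂ hV₂')
  set U₁ := π T₁.stringOp * V₁
  set U₂ := π T₂.stringOp * V₂
  refine ⟨U₁, U₂, hU₁, hU₂, ?_⟩
  -- The endomorphisms eventually contribute only scalars, so the limit is first taken without them.
  have h1 : StrongTendsto (fun K => π (star (T₁.net K)) * (star U₂ * U₁ * π (T₂.net K)))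
      (star U₁ * (star U₂ * U₁ * U₂)) :=
    hU₁'.mul (hU₂.const_mul (star U₂ * U₁)) fun K => norm_representation_le_one π
      (by rw [star_star, hn])
  -- Exchanging U₁ and U₂ on the right brings each isometry next to its adjoint.
  have h2 : star U₁ * (star U₂ * U₁ * U₂) = phase (commutatorExponent T₁ T₂) • π 1 := by
    rw [mul_assoc, hc, mul_smul_comm, mul_smul_comm, ← mul_assoc (star U₂), hs₂, one_mul, hs₁,
      map_one]
  rw [h2] at h1
  have h3 := h1.const_smul (phase (T₁.rhoExponent T₂ - T₂.rhoExponent T₁))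
  rw [smul_smul, ← phase_add, ← braidingTerms_sub] at h3
  refine h3.congr ?_
  filter_upwards [T₁.eventually_rho_star_net T₂, T₂.eventually_rho_net T₁] with K hK hK'
  rw [hK, hK', map_smul, map_smul, sub_eq_add_neg, phase_add]
  simp only [smul_mul_assoc, mul_smul_comm, smul_smul, mul_assoc, mul_comm]

end GroundState

end TransportData

end CellModel

end

open CellModel in
/-- Convergence of the braiding net and the value of its limit. `C` is a CW complex, the sites are its
`n`-cells, and `π₀` is the GNS representation of a pure frustration free ground state `ω₀`. -/
theorem proposition8p2 {X : Type*} [TopologicalSpace X] [T2Space X] (C : Set X)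
    [Topology.CWComplex C] [LocallyFiniteIncidence C] (n : ℕ)
    {G : Type*} [AddCommGroup G] [Finite G]
    (ω₀ : QuasiLocal (Topology.RelCWComplex.cell C n) G →ₗ[ℂ] ℂ)
    (hpure : IsPureState ω₀)
    (hω₀ : IsFrustrationFree (upperIncidence C n) (lowerIncidence C n) ω₀)
    {H : Type*} [NormedAddCommGroup H] [InnerProductSpace ℂ H] [CompleteSpace H]
    (π₀ : QuasiLocal (Topology.RelCWComplex.cell C n) G →⋆ₐ[ℂ] (H →L[ℂ] H)) (Ω₀ : H)
    (hπ₀ : IsGNS ω₀ π₀ Ω₀)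
    (T₁ T₂ : TransportData (upperIncidence C n) (lowerIncidence C n) G) :
    ∃ U₁ U₂ : H →L[ℂ] H,
      StrongTendsto (fun K => π₀ (T₁.net K)) U₁ ∧
      StrongTendsto (fun K => π₀ (T₂.net K)) U₂ ∧
      StrongTendsto
        (fun K => π₀ (rho T₂.γ T₂.δ (star (T₁.net K))) * star U₂ * U₁ *
          π₀ (rho T₁.γ T₁.δ (T₂.net K)))
        (phase (TransportData.braidingTerms T₁ T₂ - TransportData.braidingTerms T₂ T₁) •
          π₀ 1) := by
  exact TransportData.exists_strongTendsto_braiding T₁ T₂ hω₀ hπ₀
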